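/- Fix an integer $p\ge 2$. Let $z^{\rm r}\in\mathbb R^p$ have positive components. For $N\subseteq\mathbb R^p$ let $D(N)=\{y: z\leqq y\leqq z^{\rm r}\text{ for some }z\in N\}$ (where $\leqq$ is the componentwise order), let $V(N)$ be the Lebesgue measure of $D(N)$ (the hypervolume), and let the upper bound set $U(N)$ be the set of all maximal points $u$ (componentwise) among the points $u\in[0,z^{\rm r}]$ for which no $z\in N$ satisfies $0\le z_j<u_j$ for all $j$. A set $N$ is stable if $y\leqq z$ with $y,z\in N$ implies $y=z$, and it is in general position if no two distinct points of $N$ agree in some component. For $u,z\in\mathbb R^p$ write $(z_j,u_{-j})$ for $u$ with its $j$-th component replaced by $z_j$. *The algorithms.* The input is a list of $n$ distinct points of the open box $(0,z^{\rm r})$ that form a stable set $N$ (not necessarily in general position). Both algorithms store a linked list of vectors $u$ together with defining points $z^1(u),\dots,z^p(u)$. The list initially consists of $u=z^{\rm r}$ with $z^k(z^{\rm r})=(z^{\rm r}_k,0_{-k})$. The input points $\bar z$ are processed one after the other. HBDA-I: every stored $u$ with $\bar z_j<u_j$ for all $j$ is replaced by all the vectors $(\bar z_j,u_{-j})$, $j=1,\dots,p$,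 for which $\bar z_j\ge\max_{k\ne j}z^k_j(u)$; the defining points of $(\bar z_j,u_{-j})$ are $\bar z$ for component $j$ and $z^k(u)$ for the components $k\neq j$. At the end the volumes of the boxes $B(u)=[z^1_1(u),z^{\rm r}_1]\times\prod_{j=2}^p[\max_{k<j}z^k_j(u),u_j)$ of all stored $u$ are added up. HBDA-NI: the input is sorted in nondecreasing order of a component $q$. Every stored $u$ with $\bar z_j<u_j$ for all $j$ is removed; the volume of the box of $(\bar z_q,u_{-q})$ is added to an accumulator, and the vectors $(\bar z_j,u_{-j})$ with $j\ne q$ that satisfy the above condition are stored. At the end the volumes of the boxes of all stored $u$ are added to the accumulator. Time is the number of elementary operations (real arithmetic and comparisons, index comparisons, memory accesses, steps along a list) in the unit-cost real RAM model. All constants below depend on $p$ only. *Claims.* 1. HBDA-I returns $V(N)$, and for $n\ge1$ it does so in time $t_{\rm I}(n,p)=O(n^{\lfloor p/2\rfloor+1})$. 2. HBDA-NI, for every component $q$ and every input sorted in nondecreasing order of component $q$, returns $V(N)$, and for $n\ge1$ it does so in time $t_{\rm NI}(n,p)=O(n^{\lfloor (p-1)/2\rfloor+1})$. 3. In both algorithms,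 the treatment of one stored $u$ when a point is processed takes a time bounded by a constant, and processing a point takes a time bounded by a constant times one plus the number of stored $u$. 4. The worst-case size of an upper bound set of $n$ points is $\Theta(n^{\lfloor p/2\rfloor})$: there are constants $c,C>0$ such that, for all $z^{\rm r}$ with positive components and all $n\ge1$, every stable set $N\subset(0,z^{\rm r})$ of $n$ points has a finite upper bound set with $|U(N)|\le C\,n^{\lfloor p/2\rfloor}$, and some stable set $N\subset(0,z^{\rm r})$ of $n$ points in general position has $|U(N)|\ge c\,n^{\lfloor p/2\rfloor}$. -/

import Mathlib

namespace HBDA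

/-! ## Dominance, hypervolume and upper bound sets -/

/-- The dominated region `D(N)` with respect to the reference point `zr`. The order on
`Fin p → ℝ` is componentwise, i.e. it is weak dominance. -/
def dominatedRegion {p : ℕ} (zr : Fin p → ℝ) (N : Set (Fin p → ℝ)) : Set (Fin p → ℝ) :=
  {y | ∃ z ∈ N, z ≤ y ∧ y ≤ zr}

/-- The hypervolume `V(N)`: the Lebesgue measure of the dominated region. -/
noncomputable def hypervolume {p : ℕ} (zr : Fin p → ℝ) (N : Set (Fin p → ℝ)) : ℝ :=
  (MeasureTheory.volume (dominatedRegion zr N)).toReal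

/-- `z` lies in the open box `(0, zr)`. -/
def InBox {p : ℕ} (zr z : Fin p → ℝ) : Prop :=
  ∀ j, 0 < z j ∧ z j < zr j

/-- No point of `N` dominates another one. -/
def Stable {p : ℕ} (N : Set (Fin p → ℝ)) : Prop :=
  ∀ y ∈ N, ∀ z ∈ N, ¬ (y ≤ z ∧ y ≠ z)

/-- No two distinct points of `N` share a component value. -/
def GeneralPosition {p : ℕ} (N : Set (Fin p → ℝ)) : Prop :=
  ∀ j, Set.InjOn (fun z => z j) N

/-- The half-open box `[0, u)` contains no point of `N`. -/
def BoxFree {p : ℕ} (N : Set (Fin p → ℝ)) (u : Fin p → ℝ) : Prop :=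
  ∀ z ∈ N, ¬ ∀ j, 0 ≤ z j ∧ z j < u j

/-- The upper bound set `U(N)`: the maximal points `u` of `[0, zr]` such that `[0, u)` contains
no point of `N`. -/
def upperBoundSet {p : ℕ} (zr : Fin p → ℝ) (N : Set (Fin p → ℝ)) : Set (Fin p → ℝ) :=
  {u | Maximal (fun v => v ∈ Set.Icc 0 zr ∧ BoxFree N v) u}

/-- The points of the list `L` form an admissible input for the reference point `zr`: they are
distinct, lie in the open box `(0, zr)` and form a stable set. They need not be in general
position, and their order in `L` is the order in which they are processed. -/
structure IsInput {p : ℕ} (zr : Fin p → ℝ) (L : List (Fin p → ℝ)) : Prop where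
  zr_pos : ∀ j, 0 < zr j
  nodup : L.Nodup
  inBox : ∀ z ∈ L, InBox zr z
  stable : Stable {z | z ∈ L}

/-! ## Step counting in the unit-cost real RAM model -/

/-- A computation with result `val` that performs `steps` elementary operations. -/
structure TimeM (α : Type) where
  val : α
  steps : ℕ

instance : Monad TimeM where
  pure a := ⟨a, 0⟩
  bind x f := ⟨(f x.val).val, x.steps + (f x.val).steps⟩

/-- One elementary operation with result `a`. -/
def op {α : Type} (a : α) : TimeM α := ⟨a, 1⟩

noncomputable def ltR (a b : ℝ) : TimeM Bool := op (decide (a < b))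

noncomputable def leR (a b : ℝ) : TimeM Bool := op (decide (a ≤ b))

noncomputable def addR (a b : ℝ) : TimeM ℝ := op (a + b)

noncomputable def subR (a b : ℝ) : TimeM ℝ := op (a - b)

noncomputable def mulR (a b : ℝ) : TimeM ℝ := op (a * b)

def eqIdx {p : ℕ} (j k : Fin p) : TimeM Bool := op (decide (j = k))

def ltIdx {p : ℕ} (j k : Fin p) : TimeM Bool := op (decide (j < k))

/-- Is `j` the first index? -/
def isFirst {p : ℕ} (j : Fin p) : TimeM Bool := op (decide (j.val = 0))

/-- Read one cell of an array. -/
def read {p : ℕ} {α : Type} (v : Fin p → α) (j : Fin p) : TimeM α := op (v j)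

/-- Put a new cell in front of a linked list. -/
def push {α : Type} (a : α) (l : List α) : TimeM (List α) := op (a :: l)

/-- Fill a new array of length `p`: compute each entry, and spend one operation to write it. -/
def tabulate {p : ℕ} {α : Type} (f : Fin p → TimeM α) : TimeM (Fin p → α) :=
  ⟨fun k => (f k).val, ∑ k, ((f k).steps + 1)⟩

/-- Run through a list with an accumulator; one operation per list cell (and one for the end of
the list) on top of the cost of the loop body. -/
def loop {α β : Type} (f : β → α → TimeM β) : β → List α → TimeM β
  | b, [] => op b
  | b, a :: l => do
    let b' ← f b a
    let b'' ← op b'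
    loop f b'' l

/-- Run through a list until a test fails; costs as for `loop`. -/
def allLoop {α : Type} (f : α → TimeM Bool) : List α → TimeM Bool
  | [] => op true
  | a :: l => do
    let b ← f a
    let b' ← op b
    if b' then allLoop f l else pure false

/-! ## The algorithms -/

/-- A stored local upper bound: the vector `u` together with (references to) its defining points
`pts 0, …, pts (p - 1)`, where `pts k` defines component `k`. -/
structure LUB (p : ℕ) where
  u : Fin p → ℝ
  pts : Fin p → (Fin p → ℝ)

/-- The test `z < u` in all components. -/
noncomputable def strictDomTest {p : ℕ} (z u : Fin p → ℝ) : TimeM Bool :=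
  allLoop (fun j => do
    let a ← read z j
    let b ← read u j
    ltR a b) (List.finRange p)

/-- The test `z_j ≥ max_{k ≠ j} z^k_j(u)`. -/
noncomputable def validTest {p : ℕ} (z : Fin p → ℝ) (e : LUB p) (j : Fin p) : TimeM Bool :=
  allLoop (fun k => do
    let same ← eqIdx k j
    if same then pure true
    else do
      let d ← read e.pts k
      let a ← read d j
      let b ← read z j
      leR a b) (List.finRange p)

/-- The vector `(z_j, u_{-j})` with its defining points: `z` for component `j`, the old ones for
the other components. -/
def replaceAt {p : ℕ} (z : Fin p → ℝ) (e : LUB p) (j : Fin p) : TimeM (LUB p) := do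
  let u ← tabulate fun k => do
    let same ← eqIdx k j
    if same then read z j else read e.u k
  let pts ← tabulate fun k => do
    let same ← eqIdx k j
    if same then op z else read e.pts k
  op ⟨u, pts⟩

/-- The local upper bound `zr` of the empty set; its defining points are the dummy points
`(zr_k, 0_{-k})`. -/
def topLUB {p : ℕ} (zr : Fin p → ℝ) : TimeM (LUB p) := do
  let u ← tabulate fun k => read zr k
  let pts ← tabulate fun k => tabulate fun j => do
    let same ← eqIdx j k
    if same then read zr k else op 0
  op ⟨u, pts⟩

/-- `max_{k < j} z^k_j(u)` for an index `j` that is not the first one (component values are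
nonnegative, so the running maximum may start from `0`). -/
noncomputable def maxBefore {p : ℕ} (e : LUB p) (j : Fin p) : TimeM ℝ :=
  loop (fun m k => do
    let before ← ltIdx k j
    if before then do
      let d ← read e.pts k
      let a ← read d j
      let larger ← leR m a
      if larger then pure a else pure m
    else pure m) 0 (List.finRange p)

/-- Side length in direction `j` of the box
`B(u) = [z^1_1(u), zr_1] × ∏_{j ≥ 2} [max_{k < j} z^k_j(u), u_j)`. -/
noncomputable def sideLength {p : ℕ} (zr : Fin p → ℝ) (e : LUB p) (j : Fin p) : TimeM ℝ := do
  let first ← isFirst j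
  if first then do
    let r ← read zr j
    let d ← read e.pts j
    let a ← read d j
    subR r a
  else do
    let b ← read e.u j
    let m ← maxBefore e j
    subR b m

/-- The volume of `B(u)`. -/
noncomputable def boxVolume {p : ℕ} (zr : Fin p → ℝ) (e : LUB p) : TimeM ℝ :=
  loop (fun v j => do
    let s ← sideLength zr e j
    mulR v s) 1 (List.finRange p)

/-- Add the volumes of the boxes of all stored local upper bounds to `v`. -/
noncomputable def addBoxVolumes {p : ℕ} (zr : Fin p → ℝ) (v : ℝ) (U : List (LUB p)) : TimeM ℝ :=
  loop (fun w e => do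
    let b ← boxVolume zr e
    addR w b) v U

/-! ### Incremental algorithm -/

/-- Treat one stored local upper bound `e` when `z` is inserted: if `z < u`, replace it by all
valid `(z_j, u_{-j})`, otherwise keep it. `acc` is the new list built so far. -/
noncomputable def updateI {p : ℕ} (z : Fin p → ℝ) (acc : List (LUB p)) (e : LUB p) :
    TimeM (List (LUB p)) := do
  let hit ← strictDomTest z e.u
  if hit then
    loop (fun acc' j => do
      let valid ← validTest z e j
      if valid then do
        let e' ← replaceAt z e j
        push e' acc'
      else pure acc') acc (List.finRange p)
  else push e acc

/-- Update the stored upper bound set when the point `z` is inserted. -/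
noncomputable def insertI {p : ℕ} (z : Fin p → ℝ) (U : List (LUB p)) : TimeM (List (LUB p)) :=
  loop (updateI z) [] U

/-- The upper bound set after all points of `L` have been inserted in the given order. -/
noncomputable def ubsI {p : ℕ} (zr : Fin p → ℝ) (L : List (Fin p → ℝ)) :
    TimeM (List (LUB p)) := do
  let e ← topLUB zr
  let U₀ ← push e []
  loop (fun U z => insertI z U) U₀ L

/-- HBDA-I: compute the upper bound set incrementally and add up the box volumes. -/
noncomputable def hbdaI {p : ℕ} (zr : Fin p → ℝ) (L : List (Fin p → ℝ)) : TimeM ℝ := do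
  let U ← ubsI zr L
  addBoxVolumes zr 0 U

/-! ### Nonincremental algorithm, for points sorted by component `q` -/

/-- State of the nonincremental algorithm: the list of the local upper bounds with
`u_q = zr_q`, and the total volume of the boxes of all other local upper bounds found so far.
The latter can no longer change, so they are not stored. -/
structure StateNI (p : ℕ) where
  active : List (LUB p)
  vol : ℝ

/-- Treat one stored local upper bound `e` when `z` is processed: if `z < u`, then the new local
upper bound `(z_q, u_{-q})` is final and its box is accounted for, and the valid
`(z_j, u_{-j})` with `j ≠ q` are stored; otherwise `e` is kept. -/
noncomputable def updateNI {p : ℕ} (q : Fin p) (zr z : Fin p → ℝ) (s : StateNI p) (e : LUB p) :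
    TimeM (StateNI p) := do
  let hit ← strictDomTest z e.u
  if hit then do
    let e' ← replaceAt z e q
    let b ← boxVolume zr e'
    let v ← addR s.vol b
    let acc ← loop (fun acc' j => do
      let same ← eqIdx j q
      if same then pure acc'
      else do
        let valid ← validTest z e j
        if valid then do
          let e'' ← replaceAt z e j
          push e'' acc'
        else pure acc') s.active (List.finRange p)
    op ⟨acc, v⟩
  else do
    let acc ← push e s.active
    op ⟨acc, s.vol⟩

/-- Process the point `z`. -/
noncomputable def insertNI {p : ℕ} (q : Fin p) (zr z : Fin p → ℝ) (s : StateNI p) :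
    TimeM (StateNI p) :=
  loop (updateNI q zr z) ⟨[], s.vol⟩ s.active

/-- HBDA-NI: process the points in the given order (which has to be sorted by component `q`), and
finally account for the boxes of the local upper bounds that are still stored. -/
noncomputable def hbdaNI {p : ℕ} (q : Fin p) (zr : Fin p → ℝ) (L : List (Fin p → ℝ)) :
    TimeM ℝ := do
  let e ← topLUB zr
  let U₀ ← push e []
  let s ← loop (fun s z => insertNI q zr z s) ⟨U₀, 0⟩ L
  addBoxVolumes zr s.vol s.active

end HBDA

namespace HBDA

/-! ## Values and step counts of the basic operations -/

section TimeM

variable {α β : Type}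

/-! Everything rests on two descriptions of local upper bounds. The first, `LubOn`, says that no
point lies strictly below `u`, and that each component of `u` is either the top value or attained by
a point strictly below `u` in the other components. Such a vector is determined by its components
other than any one fixed `q`. Among the defining points of the non-top components other than `q`,
take one, for component `k`, that is largest in component `q`. The components `q` and `k` can then
be dropped, and what remains is a local upper bound of a subset of the points. So two components
cost a factor of order `n`, and `card_le_of_lubOn` yields the exponent `⌊p/2⌋`. The second,
`IsDefining`, also records the defining points and needs general position. Arbitrary inputs are
brought into this setting by breaking ties with the position in the input (`tag`): the newest point
counts as larger, which is exactly what a strict hit test and a nonstrict validity test do. With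
`isDefining_insert_iff` the list of HBDA-I then corresponds, with multiplicities, to the tagged
local upper bounds (`exists_stored_list`). For correctness, the local upper bound whose box contains
a dominated `y` is found by a greedy choice of one component after another. Uniqueness of this
choice makes the boxes disjoint (`eq_of_inLubBox`), and its existence makes them cover the dominated
region (`exists_inLubBox`). HBDA-NI is compared with HBDA-I (`exists_final_list`): sorting makes
every replacement in component `q` valid and final. The vectors still stored have `u q = zr q`, so
one component fewer has to be counted. The matching lower bound splits the points into `⌊p/2⌋`
staircases, each in its own pair of components; corners of the staircases can be combined freely
(`exists_large_upperBoundSet`). -/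

@[simp] theorem bind_val (x : TimeM α) (f : α → TimeM β) : (x >>= f).val = (f x.val).val := (rfl)

@[simp] theorem bind_steps (x : TimeM α) (f : α → TimeM β) :
    (x >>= f).steps = x.steps + (f x.val).steps := (rfl)

@[simp] theorem pure_val (a : α) : (pure a : TimeM α).val = a := (rfl)

@[simp] theorem pure_steps (a : α) : (pure a : TimeM α).steps = 0 := (rfl)

@[simp] theorem op_val (a : α) : (op a).val = a := (rfl)

@[simp] theorem op_steps (a : α) : (op a).steps = 1 := (rfl)

@[simp] theorem ite_val (c : Prop) [Decidable c] (x y : TimeM α) :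
    (if c then x else y).val = if c then x.val else y.val := apply_ite _ _ _ _

@[simp] theorem ite_steps (c : Prop) [Decidable c] (x y : TimeM α) :
    (if c then x else y).steps = if c then x.steps else y.steps := apply_ite _ _ _ _

theorem loop_val (f : β → α → TimeM β) (b : β) (l : List α) :
    (loop f b l).val = l.foldl (fun b a => (f b a).val) b := by
  induction l generalizing b with
  | nil => rfl
  | cons a l ih => simp [loop, ih]

theorem loop_steps_le {f : β → α → TimeM β} {c : ℕ} (h : ∀ b a, (f b a).steps ≤ c) (b : β)
    (l : List α) : (loop f b l).steps ≤ (c + 1) * l.length + 1 := by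
  induction l generalizing b with
  | nil => simp [loop]
  | cons a l ih =>
    have h1 := h b a
    have h2 := ih (f b a).val
    simp only [loop, bind_steps, op_steps, op_val, List.length_cons]
    linarith

theorem loop_concat_steps (f : β → α → TimeM β) (b : β) (l : List α) (a : α) :
    (loop f b (l ++ [a])).steps = (loop f b l).steps + (f (loop f b l).val a).steps + 1 := by
  induction l generalizing b with
  | nil => simp [loop]; omega
  | cons x l ih =>
    simp only [List.cons_append, loop, bind_steps, op_steps, op_val, ih, bind_val]
    omega

theorem allLoop_val (f : α → TimeM Bool) (l : List α) :
    (allLoop f l).val = l.all fun a => (f a).val := by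
  induction l with
  | nil => rfl
  | cons a l ih =>
    simp only [allLoop, bind_val, op_val, ite_val, ih, pure_val, List.all_cons]
    cases (f a).val <;> simp

theorem allLoop_steps_le {f : α → TimeM Bool} {c : ℕ} (h : ∀ a, (f a).steps ≤ c) (l : List α) :
    (allLoop f l).steps ≤ (c + 1) * l.length + 1 := by
  induction l with
  | nil => simp [allLoop]
  | cons a l ih =>
    have h1 := h a
    simp only [allLoop, bind_steps, op_steps, op_val, ite_steps, pure_steps, List.length_cons]
    split_ifs <;> nlinarith

theorem tabulate_steps_le {p c : ℕ} {f : Fin p → TimeM α} (h : ∀ k, (f k).steps ≤ c) :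
    (tabulate f).steps ≤ p * (c + 1) := by
  have h1 := Finset.sum_le_card_nsmul Finset.univ (fun k => (f k).steps + 1) (c + 1)
    fun k _ => Nat.succ_le_succ (h k)
  simpa [tabulate] using h1

end TimeM

/-! ### Operation counts of the building blocks, depending on `p` only. -/

section Steps

variable {p : ℕ}

theorem strictDomTest_steps_le (z u : Fin p → ℝ) : (strictDomTest z u).steps ≤ 4 * p + 1 := by
  refine (allLoop_steps_le (c := 3) (fun j => ?_) _).trans (by simp)
  simp [read, ltR]

theorem validTest_steps_le (z : Fin p → ℝ) (e : LUB p) (j : Fin p) :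
    (validTest z e j).steps ≤ 6 * p + 1 := by
  refine (allLoop_steps_le (c := 5) (fun j => ?_) _).trans (by simp)
  simp only [read, leR, eqIdx, bind_steps, op_steps, ite_steps, pure_steps]
  split_ifs <;> omega

theorem replaceAt_steps_le (z : Fin p → ℝ) (e : LUB p) (j : Fin p) :
    (replaceAt z e j).steps ≤ 6 * p + 1 := by
  simp only [replaceAt, bind_steps, op_steps]
  refine (add_le_add (tabulate_steps_le (c := 2) fun k => ?_)
    (add_le_add (tabulate_steps_le (c := 2) fun k => ?_) le_rfl)).trans (by omega) <;>
  · simp only [read, eqIdx, bind_steps, op_steps, ite_steps]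
    split_ifs <;> omega

theorem topLUB_steps_le (zr : Fin p → ℝ) : (topLUB zr).steps ≤ p * (3 * p + 3) + 1 := by
  simp only [topLUB, bind_steps, op_steps]
  refine (add_le_add (tabulate_steps_le (c := 1) fun k => ?_)
    (add_le_add (tabulate_steps_le (c := p * 3) fun k =>
      tabulate_steps_le (c := 2) fun j => ?_) le_rfl)).trans (by nlinarith)
  · simp [read]
  · simp only [read, eqIdx, bind_steps, op_steps, ite_steps]
    split_ifs <;> omega

theorem maxBefore_steps_le (e : LUB p) (j : Fin p) : (maxBefore e j).steps ≤ 5 * p + 1 := by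
  refine (loop_steps_le (c := 4) (fun m k => ?_) _ _).trans (by simp)
  simp only [read, leR, ltIdx, bind_steps, op_steps, ite_steps, pure_steps]
  split_ifs <;> omega

theorem sideLength_steps_le (zr : Fin p → ℝ) (e : LUB p) (j : Fin p) :
    (sideLength zr e j).steps ≤ 5 * p + 5 := by
  have := maxBefore_steps_le e j
  simp only [sideLength, isFirst, read, subR, bind_steps, op_steps, ite_steps]
  split_ifs <;> omega

theorem boxVolume_steps_le (zr : Fin p → ℝ) (e : LUB p) :
    (boxVolume zr e).steps ≤ (5 * p + 7) * p + 1 := by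
  refine (loop_steps_le (c := 5 * p + 6) (fun m k => ?_) _ _).trans (by simp)
  have := sideLength_steps_le zr e k
  simp only [mulR, bind_steps, op_steps]
  omega

theorem addBoxVolumes_steps_le (zr : Fin p → ℝ) (v : ℝ) (U : List (LUB p)) :
    (addBoxVolumes zr v U).steps ≤ ((5 * p + 7) * p + 3) * (U.length + 1) := by
  refine (loop_steps_le (c := (5 * p + 7) * p + 2) (fun m k => ?_) _ _).trans (by nlinarith)
  have := boxVolume_steps_le zr k
  simp only [addR, bind_steps, op_steps]
  omega

/-- A bound for the number of operations spent on one stored local upper bound. -/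
def stepBound (p : ℕ) : ℕ := (5 * p + 7) * p + 10 * p + 8 + (12 * p + 5) * p

theorem updateI_steps_le (z : Fin p → ℝ) (acc : List (LUB p)) (e : LUB p) :
    (updateI z acc e).steps ≤ stepBound p := by
  have h1 := strictDomTest_steps_le z e.u
  simp only [updateI, bind_steps, ite_steps, push, op_steps]
  have h2 := loop_steps_le (c := 12 * p + 3) (f := fun acc' j => do
      let valid ← validTest z e j
      if valid then do
        let e' ← replaceAt z e j
        push e' acc'
      else pure acc') (fun b j => by
    have h3 := validTest_steps_le z e j
    have h4 := replaceAt_steps_le z e j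
    simp only [push, bind_steps, ite_steps, op_steps, pure_steps]
    split_ifs <;> omega) acc (List.finRange p)
  rw [List.length_finRange] at h2
  simp only [push] at h2
  unfold stepBound
  split_ifs <;> nlinarith

theorem updateNI_steps_le (q : Fin p) (zr z : Fin p → ℝ) (s : StateNI p) (e : LUB p) :
    (updateNI q zr z s e).steps ≤ stepBound p := by
  have h1 := strictDomTest_steps_le z e.u
  have h5 := replaceAt_steps_le z e q
  have h6 := boxVolume_steps_le zr (replaceAt z e q).val
  simp only [updateNI, bind_steps, ite_steps, push, op_steps, addR]
  have h2 := loop_steps_le (c := 12 * p + 4) (f := fun acc' j => do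
      let same ← eqIdx j q
      if same then pure acc'
      else do
        let valid ← validTest z e j
        if valid then do
          let e'' ← replaceAt z e j
          push e'' acc'
        else pure acc') (fun b j => by
    have h3 := validTest_steps_le z e j
    have h4 := replaceAt_steps_le z e j
    simp only [push, eqIdx, bind_steps, ite_steps, op_steps, pure_steps]
    split_ifs <;> omega) s.active (List.finRange p)
  rw [List.length_finRange] at h2
  simp only [push] at h2
  unfold stepBound
  split_ifs <;> nlinarith

theorem insertI_steps_le (z : Fin p → ℝ) (U : List (LUB p)) :
    (insertI z U).steps ≤ (stepBound p + 1) * (U.length + 1) := by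
  refine (loop_steps_le (updateI_steps_le z) _ _).trans (by nlinarith)

theorem insertNI_steps_le (q : Fin p) (zr z : Fin p → ℝ) (s : StateNI p) :
    (insertNI q zr z s).steps ≤ (stepBound p + 1) * (s.active.length + 1) := by
  refine (loop_steps_le (updateNI_steps_le q zr z) _ _).trans (by nlinarith)

end Steps

/-! ### Results of the building blocks, freed from the step counting. -/

section Values

variable {p : ℕ}

/-- The result of `replaceAt`. -/
def replaced (z : Fin p → ℝ) (e : LUB p) (j : Fin p) : LUB p :=
  ⟨Function.update e.u j (z j), Function.update e.pts j z⟩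

/-- The condition that is tested by `validTest`. -/
def Valid (z : Fin p → ℝ) (e : LUB p) (j : Fin p) : Prop :=
  ∀ k, k ≠ j → e.pts k j ≤ z j

theorem strictDomTest_val (z u : Fin p → ℝ) :
    (strictDomTest z u).val = true ↔ ∀ j, z j < u j := by
  simp [strictDomTest, allLoop_val, read, ltR]

theorem validTest_val (z : Fin p → ℝ) (e : LUB p) (j : Fin p) :
    (validTest z e j).val = true ↔ Valid z e j := by
  simp only [validTest, allLoop_val, read, leR, eqIdx, bind_val, op_val, ite_val, pure_val,
    List.all_eq_true, List.mem_finRange, forall_true_left, Valid]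
  refine forall_congr' fun k => ?_
  by_cases h : k = j <;> simp [h]

theorem replaceAt_val (z : Fin p → ℝ) (e : LUB p) (j : Fin p) :
    (replaceAt z e j).val = replaced z e j := by
  simp only [replaceAt, replaced, bind_val, op_val, tabulate, read, eqIdx, ite_val]
  congr 1 <;> funext k <;> by_cases h : k = j
  · subst h; simp
  · simp [h]
  · subst h; simp
  · simp [h]

theorem topLUB_val (zr : Fin p → ℝ) :
    (topLUB zr).val = ⟨zr, fun k => Function.update 0 k (zr k)⟩ := by
  simp only [topLUB, bind_val, op_val, tabulate, read, eqIdx, ite_val]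
  congr 1
  funext k j
  by_cases h : j = k
  · subst h; simp
  · simp [h]

open Classical in
/-- The local upper bounds by which `e` is replaced when `z` is inserted, restricted to the
replacements of components in `P`. -/
noncomputable def updated (P : Fin p → Prop) (z : Fin p → ℝ) (e : LUB p) : List (LUB p) :=
  if ∀ j, z j < e.u j then
    ((List.finRange p).filter fun j => P j ∧ Valid z e j).map (replaced z e)
  else [e]

/-- Pushing to the front builds the new list in reverse. The order does not matter later, since
stored lists are compared only up to permutation. -/
theorem foldl_reverse_append {α β : Type*} (g : α → List β) (acc : List β) (l : List α) :
    l.foldl (fun acc a => (g a).reverse ++ acc) acc = (l.flatMap g).reverse ++ acc := by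
  induction l generalizing acc with
  | nil => simp
  | cons a l ih => simp [ih]

theorem foldl_push {α β : Type*} (P : α → Prop) [DecidablePred P] (g : α → β) (acc : List β) (l : List α) :
    l.foldl (fun acc a => if P a then g a :: acc else acc) acc =
      ((l.filter P).map g).reverse ++ acc := by
  induction l generalizing acc with
  | nil => simp
  | cons a l ih => by_cases h : P a <;> simp [ih, h]

theorem updateI_val (z : Fin p → ℝ) (acc : List (LUB p)) (e : LUB p) :
    (updateI z acc e).val = (updated (fun _ => True) z e).reverse ++ acc := by
  classical
  simp only [updateI, bind_val, ite_val, push, op_val, loop_val, pure_val, strictDomTest_val,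
    validTest_val, updated, replaceAt_val]
  split_ifs
  · simp [foldl_push]
  · simp

theorem insertI_val (z : Fin p → ℝ) (U : List (LUB p)) :
    (insertI z U).val = (U.flatMap (updated (fun _ => True) z)).reverse := by
  simp only [insertI, loop_val, updateI_val, foldl_reverse_append, List.append_nil]

open Classical in
theorem updateNI_val (q : Fin p) (zr z : Fin p → ℝ) (s : StateNI p) (e : LUB p) :
    (updateNI q zr z s e).val = ⟨(updated (fun j => j ≠ q) z e).reverse ++ s.active,
      s.vol + if ∀ j, z j < e.u j then (boxVolume zr (replaced z e q)).val else 0⟩ := by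
  have key : ∀ (acc : List (LUB p)) (j : Fin p),
      (if j = q then acc else if Valid z e j then replaced z e j :: acc else acc) =
      if j ≠ q ∧ Valid z e j then replaced z e j :: acc else acc := by
    intro acc j
    by_cases h : j = q <;> simp [h]
  simp only [updateNI, bind_val, ite_val, push, op_val, loop_val, pure_val, strictDomTest_val,
    validTest_val, updated, replaceAt_val, addR, eqIdx, decide_eq_true_eq, key]
  split_ifs
  · rw [foldl_push fun j => j ≠ q ∧ Valid z e j]
    congr!
  · simp

open Classical in
theorem insertNI_val (q : Fin p) (zr z : Fin p → ℝ) (s : StateNI p) :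
    (insertNI q zr z s).val = ⟨(s.active.flatMap (updated (fun j => j ≠ q) z)).reverse,
      s.vol + ((s.active.filter fun e => ∀ j, z j < e.u j).map fun e =>
        (boxVolume zr (replaced z e q)).val).sum⟩ := by
  have key : ∀ (l acc : List (LUB p)) (v : ℝ),
      (l.foldl (fun s e => (updateNI q zr z s e).val) ⟨acc, v⟩ : StateNI p) =
        ⟨(l.flatMap (updated (fun j => j ≠ q) z)).reverse ++ acc,
          v + ((l.filter fun e => ∀ j, z j < e.u j).map fun e =>
            (boxVolume zr (replaced z e q)).val).sum⟩ := by
    intro l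
    induction l with
    | nil => simp
    | cons e l ih =>
      intro acc v
      rw [List.foldl_cons, updateNI_val, ih]
      by_cases h : ∀ j, z j < e.u j <;> simp [h, add_assoc]
  simp only [insertNI, loop_val, key, List.append_nil]

theorem foldl_mul_eq_prod {α : Type*} (f : α → ℝ) (v : ℝ) (l : List α) :
    l.foldl (fun v a => v * f a) v = v * (l.map f).prod := by
  induction l generalizing v with
  | nil => simp
  | cons a l ih => simp [ih, mul_assoc]

theorem foldl_add_eq_sum {α : Type*} (f : α → ℝ) (v : ℝ) (l : List α) :
    l.foldl (fun v a => v + f a) v = v + (l.map f).sum := by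
  induction l generalizing v with
  | nil => simp
  | cons a l ih => simp [ih, add_assoc]

theorem boxVolume_val (zr : Fin p → ℝ) (e : LUB p) :
    (boxVolume zr e).val = ∏ j, (sideLength zr e j).val := by
  simp only [boxVolume, loop_val, bind_val, mulR, op_val]
  rw [foldl_mul_eq_prod (fun j => (sideLength zr e j).val), one_mul, ← List.ofFn_eq_map,
    List.prod_ofFn]

theorem addBoxVolumes_val (zr : Fin p → ℝ) (v : ℝ) (U : List (LUB p)) :
    (addBoxVolumes zr v U).val = v + (U.map fun e => (boxVolume zr e).val).sum := by
  simp only [addBoxVolumes, loop_val, bind_val, addR, op_val]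
  rw [foldl_add_eq_sum]

/-- The running maximum is the least upper bound of `0` and the tested values. -/
theorem maxBefore_val_le_iff (e : LUB p) (j : Fin p) (y : ℝ) :
    (maxBefore e j).val ≤ y ↔ 0 ≤ y ∧ ∀ k < j, e.pts k j ≤ y := by
  have key : ∀ (l : List (Fin p)) (m : ℝ),
      l.foldl (fun m k => if k < j then if m ≤ e.pts k j then e.pts k j else m else m) m ≤ y ↔
        m ≤ y ∧ ∀ k ∈ l, k < j → e.pts k j ≤ y := by
    intro l
    induction l with
    | nil => simp
    | cons k l ih =>
      intro m
      simp only [List.foldl_cons, ih, List.forall_mem_cons]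
      split_ifs with h1 h2
      · simp only [h1, forall_true_left]
        exact ⟨fun h => ⟨h2.trans h.1, h.1, h.2⟩, fun h => h.2⟩
      · simp only [h1, forall_true_left]
        exact ⟨fun h => ⟨h.1, (not_le.1 h2).le.trans h.1, h.2⟩, fun h => ⟨h.1, h.2.2⟩⟩
      · simp [h1]
  simp only [maxBefore, loop_val, read, leR, ltIdx, bind_val, op_val, ite_val, pure_val,
    decide_eq_true_eq]
  rw [key]
  simp

theorem sideLength_val (zr : Fin p → ℝ) (e : LUB p) (j : Fin p) :
    (sideLength zr e j).val =
      if j.val = 0 then zr j - e.pts j j else e.u j - (maxBefore e j).val := by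
  simp [sideLength, isFirst, read, subR]

end Values

/-! ## The number of local upper bounds -/

section Count

variable {ι α : Type*} [LinearOrder α]

/-- `u` is a local upper bound of `N` with respect to the components in `J`; the other components
carry the dummy value `top`. -/
structure LubOn (J : Finset ι) (top : ι → α) (N : Set (ι → α)) (u : ι → α) : Prop where
  outside : ∀ j ∉ J, u j = top j
  defining : ∀ j ∈ J, u j = top j ∨ ∃ z ∈ N, z j = u j ∧ ∀ i ∈ J, i ≠ j → z i < u i
  free : ∀ z ∈ N, ∃ j ∈ J, u j ≤ z j

variable {J : Finset ι} {top : ι → α} {N : Set (ι → α)} {u v : ι → α}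

/-- If `u q < v q`, the point defining `u q` would lie strictly below `v` in all components of `J`,
against the freeness of `v`. A top value of `u q` cannot be exceeded at all. -/
theorem LubOn.le_of_eq_off (hN : ∀ z ∈ N, ∀ j, z j < top j) (hu : LubOn J top N u)
    (hv : LubOn J top N v) {q : ι} (h : ∀ j, j ≠ q → u j = v j) : v q ≤ u q := by
  by_contra! hlt
  by_cases hq : q ∈ J
  · rcases hu.defining q hq with h1 | ⟨z, hz, hzq, hz'⟩
    · rcases hv.defining q hq with h2 | ⟨z, hz, hzq, -⟩
      · exact absurd hlt (by rw [h1, h2]; exact lt_irrefl _)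
      · have := hN z hz q
        rw [hzq, ← h1] at this
        exact lt_asymm this hlt
    · obtain ⟨j, hj, hle⟩ := hv.free z hz
      by_cases hjq : j = q
      · subst hjq
        exact absurd hlt (by rw [← hzq]; exact hle.not_gt)
      · exact absurd (hz' j hj hjq) (by rw [h j hjq]; exact hle.not_gt)
  · rw [hu.outside q hq, hv.outside q hq] at hlt
    exact lt_irrefl _ hlt

theorem LubOn.eq_of_eq_off (hN : ∀ z ∈ N, ∀ j, z j < top j) (hu : LubOn J top N u)
    (hv : LubOn J top N v) {q : ι} (h : ∀ j, j ≠ q → u j = v j) : u = v := by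
  funext j
  by_cases hj : j = q
  · subst hj
    exact le_antisymm (hv.le_of_eq_off hN hu fun i hi => (h i hi).symm) (hu.le_of_eq_off hN hv h)
  · exact h j hj

/-- Two components can be eliminated from a local upper bound `u`: component `q`, and that
component `k` whose defining point `z` is largest in component `q`. -/
theorem LubOn.exists_reduction [DecidableEq ι] {q : ι} (hq : q ∈ J) (hu : LubOn J top N u)
    (hne : ∃ k ∈ J, k ≠ q ∧ u k ≠ top k) :
    ∃ k ∈ J, k ≠ q ∧ ∃ z ∈ N, u k = z k ∧
      LubOn ((J.erase q).erase k) top {y ∈ N | y k < z k ∧ y q ≤ z q}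
        (Function.update (Function.update u q (top q)) k (top k)) := by
  classical
  have hdef : ∀ k, ∃ z, k ∈ J → u k ≠ top k → z ∈ N ∧ z k = u k ∧ ∀ i ∈ J, i ≠ k → z i < u i := by
    intro k
    by_cases h : k ∈ J ∧ u k ≠ top k
    · rcases hu.defining k h.1 with h1 | ⟨z, hz⟩
      · exact absurd h1 h.2
      · exact ⟨z, fun _ _ => hz⟩
    · exact ⟨u, fun h1 h2 => absurd ⟨h1, h2⟩ h⟩
  choose d hd using hdef
  obtain ⟨k₀, hk₀, hk₀q, hk₀t⟩ := hne
  -- Maximality in component `q` keeps the defining points of all remaining components inside the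
  -- restricted point set.
  obtain ⟨k, hk, hmax⟩ := Finset.exists_max_image
    ((J.erase q).filter fun k => u k ≠ top k) (fun k => d k q) ⟨k₀, by simp [*]⟩
  simp only [Finset.mem_filter, Finset.mem_erase] at hk hmax
  obtain ⟨⟨hkq, hkJ⟩, hkt⟩ := hk
  obtain ⟨hzN, hzk, hz⟩ := hd k hkJ hkt
  refine ⟨k, hkJ, hkq, d k, hzN, hzk.symm, ?_, ?_, ?_⟩
  · intro j hj
    by_cases hjk : j = k
    · subst hjk; simp
    · rw [Function.update_of_ne hjk]
      by_cases hjq : j = q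
      · subst hjq; simp
      · rw [Function.update_of_ne hjq]
        exact hu.outside j fun h =>
          hj (Finset.mem_erase.2 ⟨hjk, Finset.mem_erase.2 ⟨hjq, h⟩⟩)
  · intro j hj
    simp only [Finset.mem_erase] at hj
    rw [Function.update_of_ne hj.1, Function.update_of_ne hj.2.1]
    by_cases hjt : u j = top j
    · exact Or.inl hjt
    · obtain ⟨h1, h2, h3⟩ := hd j hj.2.2 hjt
      refine Or.inr ⟨d j, ⟨h1, ?_, hmax j ⟨hj.2, hjt⟩⟩, h2, fun i hi hij => ?_⟩
      · rw [hzk]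
        exact h3 k hkJ (Ne.symm hj.1)
      · simp only [Finset.mem_erase] at hi
        rw [Function.update_of_ne hi.1, Function.update_of_ne hi.2.1]
        exact h3 i hi.2.2 hij
  -- A point of the restricted set is below `u` in component `k`, and also in component `q`, because
  -- `d k q < u q`. Hence freeness of `u` is witnessed in one of the remaining components.
  · rintro y ⟨hy, hyk, hyq⟩
    obtain ⟨j, hj, hle⟩ := hu.free y hy
    have hjk : j ≠ k := by
      rintro rfl
      rw [hzk] at hyk
      exact hle.not_gt hyk
    have hjq : j ≠ q := by
      rintro rfl
      exact hle.not_gt (hyq.trans_lt (hz j hq (Ne.symm hkq)))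
    refine ⟨j, by simp [*], ?_⟩
    rwa [Function.update_of_ne hjk, Function.update_of_ne hjq]

/-- The constant in the bound for the number of local upper bounds in `m` components. -/
def lubConst : ℕ → ℕ
  | 0 => 1
  | 1 => 1
  | m + 2 => 1 + (m + 1) * lubConst m

/-- Induction in steps of two: there are `m + 1` choices of the dropped component `k` and at most
`n` choices of its defining point, and at most one vector has no non-top component besides `q`. The
base `n + 1` instead of `n` also covers the empty point set. -/
theorem card_le_of_lubOn (m n : ℕ) (J : Finset ι) (hJ : J.card = m) (N : Finset (ι → α))
    (hn : N.card ≤ n) (hN : ∀ z ∈ N, ∀ j, z j < top j) (T : Finset (ι → α))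
    (hT : ∀ u ∈ T, LubOn J top (N : Set (ι → α)) u) : T.card ≤ lubConst m * (n + 1) ^ (m / 2) := by
  classical
  induction m using Nat.strong_induction_on generalizing J N T with
  | _ m ih =>
  match m, hJ, ih with
  | 0, hJ, _ =>
    simp only [lubConst, Nat.zero_div, pow_zero, mul_one]
    rw [Finset.card_le_one]
    intro u hu v hv
    rw [Finset.card_eq_zero] at hJ
    subst hJ
    funext j
    rw [(hT u hu).outside j (by simp), (hT v hv).outside j (by simp)]
  | 1, hJ, _ =>
    simp only [lubConst, Nat.reduceDiv, pow_zero, mul_one]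
    rw [Finset.card_le_one]
    intro u hu v hv
    obtain ⟨q, rfl⟩ := Finset.card_eq_one.1 hJ
    refine (hT u hu).eq_of_eq_off (q := q) hN (hT v hv) fun j hj => ?_
    rw [(hT u hu).outside j (by simpa using hj), (hT v hv).outside j (by simpa using hj)]
  | m + 2, hJ, ih =>
    obtain ⟨q, hq⟩ : J.Nonempty := Finset.card_pos.1 (by omega)
    set red : ι → (ι → α) → (ι → α) := fun k u =>
      Function.update (Function.update u q (top q)) k (top k) with hred
    set S : ι × (ι → α) → Finset (ι → α) := fun x => T.filter fun u => u x.1 = x.2 x.1 ∧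
      LubOn ((J.erase q).erase x.1) top {y ∈ (N : Set (ι → α)) | y x.1 < x.2 x.1 ∧ y q ≤ x.2 q}
        (red x.1 u) with hS
    set T₀ := T.filter fun u => ∀ k ∈ J, k ≠ q → u k = top k with hT₀
    have hcover : T ⊆ T₀ ∪ ((J.erase q) ×ˢ N).biUnion S := by
      intro u hu
      by_cases h : ∀ k ∈ J, k ≠ q → u k = top k
      · exact Finset.mem_union_left _ (Finset.mem_filter.2 ⟨hu, h⟩)
      · push Not at h
        obtain ⟨k, hk, hkq, z, hz, h1, h2⟩ := (hT u hu).exists_reduction hq h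
        refine Finset.mem_union_right _ (Finset.mem_biUnion.2 ⟨(k, z), ?_, ?_⟩)
        · simp only [Finset.mem_product, Finset.mem_erase]
          exact ⟨⟨hkq, hk⟩, hz⟩
        · exact Finset.mem_filter.2 ⟨hu, h1, h2⟩
    have hT₀card : T₀.card ≤ 1 := by
      rw [Finset.card_le_one]
      intro u hu v hv
      rw [hT₀, Finset.mem_filter] at hu hv
      refine (hT u hu.1).eq_of_eq_off (q := q) hN (hT v hv.1) fun j hj => ?_
      by_cases hjJ : j ∈ J
      · rw [hu.2 j hjJ hj, hv.2 j hjJ hj]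
      · rw [(hT u hu.1).outside j hjJ, (hT v hv.1).outside j hjJ]
    have hScard : ∀ x ∈ (J.erase q) ×ˢ N, (S x).card ≤ lubConst m * (n + 1) ^ (m / 2) := by
      rintro ⟨k, z⟩ hx
      simp only [Finset.mem_product] at hx
      -- The reduced vector forgets the components `k` and `q`. The former is `z k`, the latter is
      -- determined by all the others.
      have hinj : Set.InjOn (red k) (S (k, z)) := by
        intro u hu v hv huv
        simp only [hS, Finset.coe_filter, Set.mem_ofPred_eq] at hu hv
        refine (hT u hu.1).eq_of_eq_off (q := q) hN (hT v hv.1) fun j hj => ?_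
        by_cases hjk : j = k
        · subst hjk
          rw [hu.2.1, hv.2.1]
        · have := congrFun huv j
          simpa [hred, Function.update_of_ne hjk, Function.update_of_ne hj] using this
      rw [← Finset.card_image_of_injOn hinj]
      refine ih m (by omega) ((J.erase q).erase k) ?_ (N.filter fun y => y k < z k ∧ y q ≤ z q)
        ((Finset.card_filter_le _ _).trans hn) (fun y hy => hN y (Finset.mem_filter.1 hy).1) _ ?_
      · rw [Finset.card_erase_of_mem hx.1, Finset.card_erase_of_mem hq, hJ]
        omega
      · intro w hw
        obtain ⟨u, hu, rfl⟩ := Finset.mem_image.1 hw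
        have := (Finset.mem_filter.1 hu).2.2
        simpa using this
    calc T.card ≤ T₀.card + (((J.erase q) ×ˢ N).biUnion S).card :=
          (Finset.card_le_card hcover).trans (Finset.card_union_le _ _)
      _ ≤ 1 + ((J.erase q) ×ˢ N).card * (lubConst m * (n + 1) ^ (m / 2)) :=
          add_le_add hT₀card (Finset.card_biUnion_le_card_mul _ _ _ hScard)
      _ ≤ 1 * ((n + 1) ^ (m / 2) * (n + 1)) +
            ((m + 1) * (n + 1)) * (lubConst m * (n + 1) ^ (m / 2)) := by
          gcongr
          · exact Nat.succ_le_of_lt (by positivity)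
          · rw [Finset.card_product, Finset.card_erase_of_mem hq, hJ]
            exact Nat.mul_le_mul (by omega) (by omega)
      _ = lubConst (m + 2) * (n + 1) ^ ((m + 2) / 2) := by
          rw [lubConst, show (m + 2) / 2 = m / 2 + 1 by omega, pow_succ]
          ring

end Count

/-! ## Local upper bounds with their defining points, in general position -/

section General

/-- The dummy point that defines component `k` of the initial local upper bound. -/
def dummy {p : ℕ} {α : Type*} (bot : α) (top : Fin p → α) (k : Fin p) : Fin p → α :=
  Function.update (fun _ => bot) k (top k)

@[simp] theorem dummy_self {p : ℕ} {α : Type*} {bot : α} {top : Fin p → α}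
    (k : Fin p) : dummy bot top k k = top k := by simp [dummy]

theorem dummy_of_ne {p : ℕ} {α : Type*} {bot : α} {top : Fin p → α}
    {j k : Fin p} (h : j ≠ k) :
    dummy bot top k j = bot := by simp [dummy, h]

variable {p : ℕ} {α : Type*} [LinearOrder α]

/-- The points of `N` lie in the open box `(bot, top)` and are in general position. -/
structure GenPos (bot : α) (top : Fin p → α) (N : Set (Fin p → α)) : Prop where
  bot_lt_top : ∀ j, bot < top j
  bot_lt : ∀ z ∈ N, ∀ j, bot < z j
  lt_top : ∀ z ∈ N, ∀ j, z j < top j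
  inj : ∀ y ∈ N, ∀ z ∈ N, ∀ j, y j = z j → y = z

/-- The points `σ k` are the defining points of the local upper bound `u` of `N` that is given by
`u k = σ k k`. -/
structure IsDefining (bot : α) (top : Fin p → α) (N : Set (Fin p → α))
    (σ : Fin p → Fin p → α) : Prop where
  mem : ∀ k, σ k ∈ N ∨ σ k = dummy bot top k
  off : ∀ k j, k ≠ j → σ k j < σ j j
  free : ∀ z ∈ N, ∃ j, σ j j ≤ z j

variable {bot : α} {top : Fin p → α} {N : Set (Fin p → α)} {σ τ : Fin p → Fin p → α}

theorem GenPos.mono {N' : Set (Fin p → α)} (h : GenPos bot top N) (hN : N' ⊆ N) :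
    GenPos bot top N' :=
  ⟨h.bot_lt_top, fun z hz => h.bot_lt z (hN hz), fun z hz => h.lt_top z (hN hz),
    fun y hy z hz => h.inj y (hN hy) z (hN hz)⟩

theorem IsDefining.bot_lt (hN : GenPos bot top N) (hσ : IsDefining bot top N σ) (k : Fin p) :
    bot < σ k k := by
  rcases hσ.mem k with h | h
  · exact hN.bot_lt _ h k
  · rw [h, dummy_self]
    exact hN.bot_lt_top k

/-- The point that defines component `k` is determined by the value of this component. -/
theorem eq_of_diag_eq (hN : GenPos bot top N) {x y : Fin p → α} {k : Fin p}
    (hx : x ∈ N ∨ x = dummy bot top k) (hy : y ∈ N ∨ y = dummy bot top k) (h : x k = y k) :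
    x = y := by
  rcases hx with hx | rfl <;> rcases hy with hy | rfl
  · exact hN.inj x hx y hy k h
  · have := hN.lt_top x hx k
    rw [h, dummy_self] at this
    exact absurd this (lt_irrefl _)
  · have := hN.lt_top y hy k
    rw [← h, dummy_self] at this
    exact absurd this (lt_irrefl _)
  · rfl

theorem IsDefining.ext_diag (hN : GenPos bot top N) (hσ : IsDefining bot top N σ)
    (hτ : IsDefining bot top N τ) (h : ∀ k, σ k k = τ k k) : σ = τ := by
  funext k
  exact eq_of_diag_eq hN (hσ.mem k) (hτ.mem k) (h k)

theorem IsDefining.lubOn (hσ : IsDefining bot top N σ) :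
    LubOn Finset.univ top N (fun k => σ k k) where
  outside j hj := absurd (Finset.mem_univ j) hj
  defining j _ := by
    rcases hσ.mem j with h | h
    · exact Or.inr ⟨σ j, h, rfl, fun i _ hij => hσ.off j i (Ne.symm hij)⟩
    · left
      simp [h]
  free z hz := by simpa using hσ.free z hz

/-- A component at its top value never witnesses freeness, since all points are strictly below
`top`. Dropping it from the count is what lowers the exponent for HBDA-NI. -/
theorem IsDefining.lubOn_erase (hN : GenPos bot top N) (hσ : IsDefining bot top N σ) {q : Fin p}
    (hq : σ q q = top q) : LubOn (Finset.univ.erase q) top N (fun k => σ k k) where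
  outside j hj := by
    have : j = q := by simpa using hj
    subst this
    exact hq
  defining j _ := (hσ.lubOn.defining j (Finset.mem_univ j)).imp_right
    fun ⟨z, hz, h1, h2⟩ => ⟨z, hz, h1, fun i _ => h2 i (Finset.mem_univ i)⟩
  free z hz := by
    obtain ⟨j, hj⟩ := hσ.free z hz
    refine ⟨j, ?_, hj⟩
    simp only [Finset.mem_erase, Finset.mem_univ, and_true]
    rintro rfl
    rw [hq] at hj
    exact hj.not_gt (hN.lt_top z hz j)

theorem isDefining_empty (hbt : ∀ j, bot < top j) :
    IsDefining bot top ∅ σ ↔ σ = dummy bot top := by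
  constructor
  · intro h
    funext k
    simpa using h.mem k
  · rintro rfl
    refine ⟨fun k => Or.inr rfl, fun k j hkj => ?_, by simp⟩
    rw [dummy_of_ne (Ne.symm hkj), dummy_self]
    exact hbt j

/-- Lowering one component of a local upper bound that is strictly dominated by a new point. -/
theorem IsDefining.update (hσ : IsDefining bot top N σ) {z : Fin p → α}
    (hz : ∀ i, z i < σ i i) {j : Fin p} (hj : ∀ k, k ≠ j → σ k j < z j) :
    IsDefining bot top (insert z N) (Function.update σ j z) where
  mem k := by
    by_cases hk : k = j
    · subst hk; simp
    · rw [Function.update_of_ne hk]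
      exact (hσ.mem k).imp_left (Set.mem_insert_of_mem _)
  off k i hki := by
    by_cases hk : k = j
    · subst hk
      rw [Function.update_self, Function.update_of_ne (Ne.symm hki)]
      exact hz i
    · rw [Function.update_of_ne hk]
      by_cases hi : i = j
      · subst hi
        rw [Function.update_self]
        exact hj k hki
      · rw [Function.update_of_ne hi]
        exact hσ.off k i hki
  free y hy := by
    rcases hy with rfl | hy
    · exact ⟨j, by simp⟩
    · obtain ⟨i, hi⟩ := hσ.free y hy
      refine ⟨i, ?_⟩
      by_cases h : i = j
      · subst h
        rw [Function.update_self]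
        exact (hz i).le.trans hi
      · rwa [Function.update_of_ne h]

/-- The local upper bounds after the insertion of a point `z`. -/
theorem isDefining_insert_iff (hfin : N.Finite) {z : Fin p → α} (hzN : z ∉ N)
    (hN : GenPos bot top (insert z N)) :
    IsDefining bot top (insert z N) τ ↔
      (IsDefining bot top N τ ∧ ¬ ∀ i, z i < τ i i) ∨
      ∃ σ, IsDefining bot top N σ ∧ (∀ i, z i < σ i i) ∧
        ∃ j, (∀ k, k ≠ j → σ k j < z j) ∧ τ = Function.update σ j z := by
  constructor
  · intro hτ
    by_cases hz : ∃ j, τ j = z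
    · right
      obtain ⟨j, hj⟩ := hz
      have hdum : ∀ i, i ≠ j → dummy bot top j i < τ i i := fun i hi => by
        rw [dummy_of_ne hi]
        exact hτ.bot_lt hN i
      -- The old local upper bound is recovered by raising component `j` until the first old point
      -- blocks it; the dummy point ensures that there is a candidate.
      obtain ⟨x, ⟨hx, hxlt⟩, hmin⟩ := Set.exists_min_image
        {x ∈ insert (dummy bot top j) N | ∀ i, i ≠ j → x i < τ i i} (fun x => x j)
        ((hfin.insert _).subset (Set.sep_subset _ _)) ⟨_, Set.mem_insert _ _, hdum⟩
      have hx' : x ∈ N ∨ x = dummy bot top j := Or.symm hx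
      -- Freeness of `τ` at `x` can only hold in component `j`, which gives `≤`; general position
      -- and `z ∉ N` make it strict.
      have hzx : z j < x j := by
        rcases hx' with hxN | rfl
        · obtain ⟨i, hi⟩ := hτ.free x (Set.mem_insert_of_mem _ hxN)
          have hij : i = j := by
            by_contra h
            exact hi.not_gt (hxlt i h)
          subst hij
          rw [hj] at hi
          refine lt_of_le_of_ne hi fun h => hzN ?_
          rw [hN.inj z (Set.mem_insert _ _) x (Set.mem_insert_of_mem _ hxN) i h]
          exact hxN
        · rw [dummy_self]
          exact hN.lt_top z (Set.mem_insert _ _) j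
      have hlt : ∀ k, k ≠ j → τ k j < z j := fun k hk => by
        have := hτ.off k j hk
        rwa [hj] at this
      refine ⟨Function.update τ j x, ⟨fun k => ?_, fun k i hki => ?_, fun y hy => ?_⟩,
        fun i => ?_, j, fun k hk => ?_, ?_⟩
      · by_cases hk : k = j
        · subst hk
          simpa using hx'
        · rw [Function.update_of_ne hk]
          refine (hτ.mem k).imp_left fun h => h.resolve_left fun hkz => ?_
          have := hlt k hk
          rw [hkz] at this
          exact lt_irrefl _ this
      · by_cases hk : k = j
        · subst hk
          rw [Function.update_self, Function.update_of_ne (Ne.symm hki)]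
          exact hxlt i (Ne.symm hki)
        · rw [Function.update_of_ne hk]
          by_cases hi : i = j
          · subst hi
            rw [Function.update_self]
            exact (hlt k hki).trans hzx
          · rw [Function.update_of_ne hi]
            exact hτ.off k i hki
      · by_cases h : ∀ i, i ≠ j → y i < τ i i
        · exact ⟨j, by simpa using hmin y ⟨Set.mem_insert_of_mem _ hy, h⟩⟩
        · push Not at h
          obtain ⟨i, hi, hle⟩ := h
          exact ⟨i, by rwa [Function.update_of_ne hi]⟩
      · by_cases hi : i = j
        · subst hi
          simpa using hzx
        · rw [Function.update_of_ne hi, ← hj]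
          exact hτ.off j i (Ne.symm hi)
      · rw [Function.update_of_ne hk]
        exact hlt k hk
      · rw [Function.update_idem, ← hj, Function.update_eq_self]
    · left
      push Not at hz
      refine ⟨⟨fun k => (hτ.mem k).imp_left fun h => h.resolve_left (hz k), hτ.off,
        fun y hy => hτ.free y (Set.mem_insert_of_mem _ hy)⟩, fun h => ?_⟩
      obtain ⟨j, hj⟩ := hτ.free z (Set.mem_insert _ _)
      exact hj.not_gt (h j)
  · rintro (⟨hτ, hz⟩ | ⟨σ, hσ, hz, j, hj, rfl⟩)
    · push Not at hz
      refine ⟨fun k => (hτ.mem k).imp_left (Set.mem_insert_of_mem _), hτ.off, ?_⟩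
      rintro y (rfl | hy)
      · exact hz
      · exact hτ.free y hy
    · exact hσ.update hz hj

/-- A local upper bound of the new set arises by a replacement in only one way. -/
theorem IsDefining.update_inj (hN : GenPos bot top N) (hσ : IsDefining bot top N σ)
    (hτ : IsDefining bot top N τ) {z : Fin p → α} {i j : Fin p} (hzσ : ∀ i, z i < σ i i)
    (h : Function.update σ i z = Function.update τ j z) :
    σ = τ ∧ i = j := by
  have hij : i = j := by
    by_contra hij
    have h1 := congrFun (congrFun h j) j
    rw [Function.update_self, Function.update_of_ne (Ne.symm hij)] at h1
    exact (hzσ j).ne h1.symm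
  subst hij
  refine ⟨hσ.ext_diag hN hτ fun k => ?_, rfl⟩
  refine congrFun (hσ.lubOn.eq_of_eq_off (q := i) hN.lt_top hτ.lubOn fun k hk => ?_) k
  have := congrFun (congrFun h k) k
  simpa [Function.update_of_ne hk] using this

/-! ## The box decomposition -/

/-- `σ j` is minimal in component `j` among all points that lie below the local upper bound in the
components before `j`, and weakly below `y` in the components after `j`. -/
structure IsGreedy (bot : α) (top : Fin p → α) (N : Set (Fin p → α)) (y : Fin p → α)
    (σ : Fin p → Fin p → α) (j : Fin p) : Prop where
  mem : σ j ∈ N ∨ σ j = dummy bot top j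
  before : ∀ i < j, σ j i < σ i i
  after : ∀ i, j < i → σ j i ≤ y i
  le : ∀ z ∈ N, (∀ i < j, z i < σ i i) → (∀ i, j < i → z i ≤ y i) → σ j j ≤ z j

variable {y : Fin p → α}

/-- Greediness at `j` involves only `σ i` with `i ≤ j`, so a greedy choice can be built index by
index. -/
theorem IsGreedy.congr {j : Fin p} (h : ∀ i ≤ j, σ i = τ i) (hσ : IsGreedy bot top N y σ j) :
    IsGreedy bot top N y τ j := by
  have hj := h j le_rfl
  refine ⟨hj ▸ hσ.mem, fun i hi => ?_, fun i hi => hj ▸ hσ.after i hi, fun z hz h1 h2 => ?_⟩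
  · rw [← hj, ← h i hi.le]
    exact hσ.before i hi
  · rw [← hj]
    refine hσ.le z hz (fun i hi => ?_) h2
    rw [h i hi.le]
    exact h1 i hi

theorem IsGreedy.bot_lt (hN : GenPos bot top N) {j : Fin p} (hσ : IsGreedy bot top N y σ j) :
    bot < σ j j := by
  rcases hσ.mem with h | h
  · exact hN.bot_lt _ h j
  · rw [h, dummy_self]
    exact hN.bot_lt_top j

/-- At each index a minimal candidate is taken. The dummy point always qualifies, because its other
components are `bot`. -/
theorem exists_isGreedy (hN : GenPos bot top N) (hfin : N.Finite) (hy : ∀ j, bot ≤ y j) :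
    ∃ σ, ∀ j, IsGreedy bot top N y σ j := by
  suffices h : ∀ m ≤ p, ∃ σ : Fin p → Fin p → α, ∀ j : Fin p, j.val < m →
      IsGreedy bot top N y σ j by
    obtain ⟨σ, hσ⟩ := h p le_rfl
    exact ⟨σ, fun j => hσ j j.isLt⟩
  intro m
  induction m with
  | zero => exact fun _ => ⟨fun _ _ => bot, by simp⟩
  | succ m ih =>
    intro hm
    obtain ⟨σ, hσ⟩ := ih (by omega)
    set j : Fin p := ⟨m, hm⟩ with hj
    obtain ⟨x, ⟨hx, hx1, hx2⟩, hmin⟩ := Set.exists_min_image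
      {x ∈ insert (dummy bot top j) N | (∀ i < j, x i < σ i i) ∧ ∀ i, j < i → x i ≤ y i}
      (fun x => x j) ((hfin.insert _).subset (Set.sep_subset _ _))
      ⟨dummy bot top j, Set.mem_insert _ _,
        fun i hi => by rw [dummy_of_ne hi.ne]; exact (hσ i hi).bot_lt hN,
        fun i hi => by rw [dummy_of_ne hi.ne']; exact hy i⟩
    refine ⟨Function.update σ j x, fun i hi => ?_⟩
    by_cases hij : i = j
    · rw [hij]
      have hlt : ∀ k < j, Function.update σ j x k = σ k := fun k hk =>
        Function.update_of_ne hk.ne _ _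
      refine ⟨by simpa using Or.symm hx, fun k hk => ?_, by simpa using hx2,
        fun z hz h1 h2 => ?_⟩
      · rw [Function.update_self, hlt k hk]
        exact hx1 k hk
      · rw [Function.update_self]
        refine hmin z ⟨Set.mem_insert_of_mem _ hz, fun k hk => ?_, h2⟩
        have := h1 k hk
        rwa [hlt k hk] at this
    · have hlt : i < j := by
        have : i.val ≠ m := fun h => hij (Fin.ext h)
        rw [Fin.lt_def]
        simp only [hj]
        omega
      refine (hσ i hlt).congr fun k hk => ?_
      rw [Function.update_of_ne (hk.trans_lt hlt).ne]

theorem isGreedy_unique (hN : GenPos bot top N) (hσ : ∀ j, IsGreedy bot top N y σ j)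
    (hτ : ∀ j, IsGreedy bot top N y τ j) : σ = τ := by
  suffices h : ∀ j, σ j = τ j from funext h
  have hle : ∀ {σ τ : Fin p → Fin p → α} (j : Fin p), IsGreedy bot top N y σ j →
      IsGreedy bot top N y τ j → (∀ i < j, σ i = τ i) → σ j j ≤ τ j j := by
    intro σ τ j hσ hτ ih
    rcases hτ.mem with h | h
    · refine hσ.le _ h (fun i hi => ?_) hτ.after
      rw [ih i hi]
      exact hτ.before i hi
    · rw [h, dummy_self]
      rcases hσ.mem with h' | h'
      · exact (hN.lt_top _ h' j).le
      · rw [h', dummy_self]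
  intro j
  induction j using WellFoundedLT.induction with
  | ind j ih =>
    exact eq_of_diag_eq hN (hσ j).mem (hτ j).mem (le_antisymm (hle j (hσ j) (hτ j) ih)
      (hle j (hτ j) (hσ j) fun i hi => (ih i hi).symm))

/-- The half-open box that belongs to a local upper bound. -/
def InLubBox (σ : Fin p → Fin p → α) (y : Fin p → α) : Prop :=
  ∀ j : Fin p, if j.val = 0 then σ j j ≤ y j else (∀ k < j, σ k j ≤ y j) ∧ y j < σ j j

/-- For a competing point `z`, freeness gives an index `i` with `σ i i ≤ z i`. It cannot precede
`j`, where `z` is below `σ`, nor follow `j`, where `z i ≤ y i < σ i i`. So it is `j` itself. -/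
theorem IsDefining.isGreedy (hσ : IsDefining bot top N σ) (hy : InLubBox σ y) (j : Fin p) :
    IsGreedy bot top N y σ j where
  mem := hσ.mem j
  before i hi := hσ.off j i hi.ne'
  after i hi := by
    have := hy i
    rw [if_neg (Nat.ne_zero_of_lt hi)] at this
    exact this.1 j hi
  le z hz h1 h2 := by
    obtain ⟨i, hi⟩ := hσ.free z hz
    rcases lt_trichotomy i j with h | h | h
    · exact absurd (h1 i h) hi.not_gt
    · exact h ▸ hi
    · have := hy i
      rw [if_neg (Nat.ne_zero_of_lt h)] at this
      exact absurd (this.2.trans_le hi) (h2 i h).not_gt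

/-- The boxes of different local upper bounds are disjoint. -/
theorem eq_of_inLubBox (hN : GenPos bot top N) (hσ : IsDefining bot top N σ)
    (hτ : IsDefining bot top N τ) (h1 : InLubBox σ y) (h2 : InLubBox τ y) : σ = τ :=
  isGreedy_unique hN (hσ.isGreedy h1) (hτ.isGreedy h2)

/-- The points in the boxes are dominated. -/
theorem IsDefining.exists_le (hp : 0 < p) (hσ : IsDefining bot top N σ) (hy : InLubBox σ y)
    (hyt : ∀ j, y j < top j) : ∃ z ∈ N, z ≤ y := by
  have h0 := hy ⟨0, hp⟩
  rw [if_pos rfl] at h0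
  rcases hσ.mem ⟨0, hp⟩ with h | h
  · refine ⟨_, h, fun j => ?_⟩
    by_cases hj : j.val = 0
    · have : j = ⟨0, hp⟩ := Fin.ext hj
      exact this ▸ h0
    · have := hy j
      rw [if_neg hj] at this
      exact this.1 _ (Nat.pos_of_ne_zero hj)
  · rw [h, dummy_self] at h0
    exact absurd (hyt _) h0.not_gt

/-- Each dominated point lies in the box of a local upper bound. -/
theorem exists_inLubBox (hp : 0 < p) (hN : GenPos bot top N) (hfin : N.Finite)
    (hy : ∃ z ∈ N, z ≤ y) (hyt : ∀ j, y j < top j) :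
    ∃ σ, IsDefining bot top N σ ∧ InLubBox σ y := by
  obtain ⟨z₀, hz₀, hle⟩ := hy
  obtain ⟨σ, hσ⟩ := exists_isGreedy hN hfin fun j => (hN.bot_lt z₀ hz₀ j).le.trans (hle j)
  -- If `σ j j ≤ y j`, then `σ j` was already a candidate at index `j - 1`, so minimality there
  -- contradicts `before` for `σ j`.
  have hlt : ∀ j : Fin p, j.val ≠ 0 → y j < σ j j := by
    intro j hj
    by_contra! h
    have hjN : σ j ∈ N := (hσ j).mem.resolve_right fun h' => by
      rw [h', dummy_self] at h
      exact h.not_gt (hyt j)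
    set i : Fin p := ⟨j.val - 1, by omega⟩ with hi
    have hij : i < j := by
      rw [Fin.lt_def]; simp only [hi]; omega
    refine ((hσ j).before i hij).not_ge ((hσ i).le _ hjN
      (fun k hk => (hσ j).before k (hk.trans hij)) fun k hk => ?_)
    have hjk : j ≤ k := by
      rw [Fin.lt_def] at hk; rw [Fin.le_def]; simp only [hi] at hk; omega
    rcases hjk.eq_or_lt with rfl | hjk
    · exact h
    · exact (hσ j).after k hjk
  refine ⟨σ, ⟨fun k => (hσ k).mem, fun k j hkj => ?_, fun z hz => ?_⟩, fun j => ?_⟩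
  · rcases lt_or_gt_of_ne hkj with h | h
    · exact ((hσ k).after j h).trans_lt (hlt j (Nat.ne_zero_of_lt h))
    · exact (hσ k).before j h
  -- At the last index no conditions on later components remain, so a point strictly below all `σ i
  -- i` would beat the minimum chosen there.
  · by_contra! h
    set l : Fin p := ⟨p - 1, by omega⟩ with hl
    refine (h l).not_ge ((hσ l).le z hz (fun i _ => h i) fun i hi => ?_)
    have := i.isLt
    rw [Fin.lt_def] at hi
    simp only [hl] at hi
    omega
  · split_ifs with hj
    · refine (hσ j).le z₀ hz₀ (fun i hi => ?_) (fun i _ => hle i) |>.trans (hle j)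
      exact absurd hi (by rw [Fin.lt_def]; omega)
    · exact ⟨fun k hk => (hσ k).after j hk, hlt j hj⟩

end General

/-! ## Breaking ties by the position in the input -/

section Tagged

variable {p : ℕ}

/-- The point `z` at position `n`, where ties between components are broken by the position. -/
def tag (n : ℕ) (z : Fin p → ℝ) : Fin p → ℝ ×ₗ ℕ := fun j => toLex (z j, n)

/-- A tie in the real value is never resolved in favour of the later position, so the tagged
comparison is the strict test on real values. -/
theorem tag_lt_iff {x : ℝ ×ₗ ℕ} {n : ℕ} (h : (ofLex x).2 ≤ n) (z : Fin p → ℝ) (j : Fin p) :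
    tag n z j < x ↔ z j < (ofLex x).1 := by
  rw [tag, Prod.Lex.lt_iff]
  simp only [ofLex_toLex]
  exact ⟨fun h' => h'.resolve_right fun h2 => by omega, Or.inl⟩

theorem le_tag_iff {x : ℝ ×ₗ ℕ} {n : ℕ} (h : (ofLex x).2 ≤ n) (z : Fin p → ℝ) (j : Fin p) :
    x ≤ tag n z j ↔ (ofLex x).1 ≤ z j := by
  rw [← not_lt, tag_lt_iff h, not_lt]

/-- Against a strictly later position every tie counts as smaller; thus the nonstrict validity test
is a strict comparison of tagged values. -/
theorem lt_tag_iff {x : ℝ ×ₗ ℕ} {n : ℕ} (h : (ofLex x).2 < n) (z : Fin p → ℝ) (j : Fin p) :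
    x < tag n z j ↔ (ofLex x).1 ≤ z j := by
  rw [← le_tag_iff h.le]
  refine ⟨le_of_lt, fun h' => lt_of_le_of_ne h' ?_⟩
  rintro rfl
  exact lt_irrefl _ h

/-- The points of `L`, where ties between components are broken by the position in `L`. -/
def tagged (L : List (Fin p → ℝ)) : List (Fin p → ℝ ×ₗ ℕ) := L.mapIdx fun i z => tag (i + 1) z

@[simp] theorem tagged_nil : tagged ([] : List (Fin p → ℝ)) = [] := rfl

theorem tagged_concat (L : List (Fin p → ℝ)) (z : Fin p → ℝ) :
    tagged (L ++ [z]) = tagged L ++ [tag (L.length + 1) z] := by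
  simp [tagged, List.mapIdx_concat]

@[simp] theorem length_tagged (L : List (Fin p → ℝ)) : (tagged L).length = L.length := by
  simp [tagged]

theorem mem_tagged {L : List (Fin p → ℝ)} {x : Fin p → ℝ ×ₗ ℕ} :
    x ∈ tagged L ↔ ∃ (i : ℕ) (h : i < L.length), tag (i + 1) L[i] = x := by
  simp [tagged, List.mem_mapIdx]

/-- The dummy value `0` of the components of the dummy points. -/
def lexBot : ℝ ×ₗ ℕ := toLex (0, 0)

/-- Equal tagged components have equal positions and hence come from the same point. Input positions
start at 1; position 0 is reserved for the top and bottom values. -/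
theorem genPos_tagged {zr : Fin p → ℝ} (hzr : ∀ j, 0 < zr j) {L : List (Fin p → ℝ)}
    (hL : ∀ z ∈ L, InBox zr z) : GenPos lexBot (tag 0 zr) {x | x ∈ tagged L} where
  bot_lt_top j := by simp [lexBot, tag, Prod.Lex.lt_iff, hzr j]
  bot_lt x hx j := by
    obtain ⟨i, hi, rfl⟩ := mem_tagged.1 hx
    simp [lexBot, tag, Prod.Lex.lt_iff, (hL _ (L.getElem_mem hi) j).1]
  lt_top x hx j := by
    obtain ⟨i, hi, rfl⟩ := mem_tagged.1 hx
    simp [tag, Prod.Lex.lt_iff, (hL _ (L.getElem_mem hi) j).2]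
  inj x hx y hy j h := by
    obtain ⟨i, hi, rfl⟩ := mem_tagged.1 hx
    obtain ⟨k, hk, rfl⟩ := mem_tagged.1 hy
    have : i = k := by
      have := congrArg (fun a => (ofLex a).2) h
      simpa [tag] using this
    subst this
    rfl

/-- `σ` are the defining points of a local upper bound for the points of `L`. -/
def IsStored (zr : Fin p → ℝ) (L : List (Fin p → ℝ)) (σ : Fin p → Fin p → ℝ ×ₗ ℕ) : Prop :=
  IsDefining lexBot (tag 0 zr) {x | x ∈ tagged L} σ

theorem IsStored.snd_le {zr : Fin p → ℝ} {L : List (Fin p → ℝ)} {σ : Fin p → Fin p → ℝ ×ₗ ℕ}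
    (hσ : IsStored zr L σ) (k j : Fin p) : (ofLex (σ k j)).2 ≤ L.length := by
  rcases hσ.mem k with h | h
  · obtain ⟨i, hi, h⟩ := mem_tagged.1 h
    rw [← h]
    exact hi
  · rw [h]
    by_cases hj : j = k
    · subst hj
      simp [tag]
    · simp [dummy_of_ne hj, lexBot]

/-- The stored local upper bound with the defining points `σ`. -/
def untag (σ : Fin p → Fin p → ℝ ×ₗ ℕ) : LUB p :=
  ⟨fun k => (ofLex (σ k k)).1, fun k j => (ofLex (σ k j)).1⟩

theorem untag_update (σ : Fin p → Fin p → ℝ ×ₗ ℕ) (n : ℕ) (z : Fin p → ℝ) (j : Fin p) :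
    untag (Function.update σ j (tag n z)) = replaced z (untag σ) j := by
  simp only [untag, replaced, LUB.mk.injEq]
  constructor <;> funext k <;> by_cases h : k = j
  · subst h; simp [tag]
  · simp [Function.update_of_ne h]
  · subst h; simp [tag]
  · simp [Function.update_of_ne h]

open Classical in
/-- The replacement of a local upper bound when the tagged point `z` is inserted. -/
noncomputable def updatedTagged (z : Fin p → ℝ ×ₗ ℕ) (σ : Fin p → Fin p → ℝ ×ₗ ℕ) :
    List (Fin p → Fin p → ℝ ×ₗ ℕ) :=
  if ∀ i, z i < σ i i then
    ((List.finRange p).filter fun j => ∀ k, k ≠ j → σ k j < z j).map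
      fun j => Function.update σ j z
  else [σ]

/-- All stored positions are at most `L.length`, so the algorithm's tests on real numbers decide the
tagged conditions for the new position `L.length + 1`. -/
theorem map_untag_updatedTagged {zr : Fin p → ℝ} {L : List (Fin p → ℝ)}
    {σ : Fin p → Fin p → ℝ ×ₗ ℕ} (hσ : IsStored zr L σ) (z : Fin p → ℝ) :
    (updatedTagged (tag (L.length + 1) z) σ).map untag =
      updated (fun _ => True) z (untag σ) := by
  have h1 : (∀ i, tag (L.length + 1) z i < σ i i) ↔ ∀ i, z i < (untag σ).u i :=
    forall_congr' fun i => tag_lt_iff ((hσ.snd_le i i).trans (Nat.le_succ _)) z i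
  have h2 : ∀ j, (∀ k, k ≠ j → σ k j < tag (L.length + 1) z j) ↔ Valid z (untag σ) j :=
    fun j => forall₂_congr fun k _ => lt_tag_iff (Nat.lt_succ_of_le (hσ.snd_le k j)) z j
  simp only [updatedTagged, updated, h1]
  split_ifs
  · rw [List.map_map]
    exact (congrArg _ (List.filter_congr fun j _ => by simpa using h2 j)).trans
      (List.map_congr_left fun j _ => untag_update _ _ _ _)
  · simp

theorem ubsI_nil_val (zr : Fin p → ℝ) : (ubsI zr []).val = [(topLUB zr).val] := by
  simp [ubsI, loop_val, push]

theorem ubsI_concat_val (zr : Fin p → ℝ) (L : List (Fin p → ℝ)) (z : Fin p → ℝ) :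
    (ubsI zr (L ++ [z])).val = (insertI z (ubsI zr L).val).val := by
  simp [ubsI, loop_val, push]

theorem untag_dummy (zr : Fin p → ℝ) :
    untag (dummy lexBot (tag 0 zr)) = (topLUB zr).val := by
  simp only [topLUB_val, untag, LUB.mk.injEq]
  constructor
  · funext k
    simp [tag]
  · funext k j
    by_cases h : j = k
    · subst h; simp [tag]
    · simp [dummy_of_ne h, h, lexBot]

theorem setOf_mem_tagged_concat (L : List (Fin p → ℝ)) (z : Fin p → ℝ) :
    {x | x ∈ tagged (L ++ [z])} = insert (tag (L.length + 1) z) {x | x ∈ tagged L} := by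
  ext x
  simp [tagged_concat, or_comm]

theorem tag_notMem_tagged {L : List (Fin p → ℝ)} (hp : 0 < p) (z : Fin p → ℝ) :
    tag (L.length + 1) z ∉ tagged L := by
  intro h
  obtain ⟨i, hi, h⟩ := mem_tagged.1 h
  have := congrArg (fun a => (ofLex a).2) (congrFun h ⟨0, hp⟩)
  simp only [tag, ofLex_toLex] at this
  omega

/-- HBDA-I stores exactly the local upper bounds of the processed points. -/
theorem exists_stored_list (hp : 0 < p) {zr : Fin p → ℝ} (hzr : ∀ j, 0 < zr j)
    (L : List (Fin p → ℝ)) (hL : ∀ z ∈ L, InBox zr z) :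
    ∃ A : List (Fin p → Fin p → ℝ ×ₗ ℕ), A.Nodup ∧ (∀ σ, σ ∈ A ↔ IsStored zr L σ) ∧
      (ubsI zr L).val.Perm (A.map untag) := by
  induction L using List.reverseRecOn with
  | nil =>
    refine ⟨[dummy lexBot (tag 0 zr)], by simp, fun σ => ?_, ?_⟩
    · have := isDefining_empty (σ := σ) (genPos_tagged (L := []) hzr (by simp)).bot_lt_top
      simp [IsStored, this]
    · simp [ubsI_nil_val, untag_dummy]
  | append_singleton L z ih =>
    obtain ⟨A, hnodup, hmem, hperm⟩ := ih fun y hy => hL y (by simp [hy])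
    have hN := genPos_tagged hzr hL
    rw [setOf_mem_tagged_concat] at hN
    have hN' := hN.mono (Set.subset_insert _ _)
    have hz : tag (L.length + 1) z ∉ {x | x ∈ tagged L} := tag_notMem_tagged hp z
    refine ⟨A.flatMap (updatedTagged (tag (L.length + 1) z)), ?_, fun τ => ?_, ?_⟩
    · rw [List.nodup_flatMap]
      constructor
      · intro σ hσ
        unfold updatedTagged
        split_ifs with h
        · refine ((List.nodup_finRange p).filter _).map_on fun i _ j _ hij => ?_
          exact (((hmem σ).1 hσ).update_inj hN' ((hmem σ).1 hσ) h hij).2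
        · simp
      · refine hnodup.pairwise_of_forall_ne fun σ hσ τ hτ hne => ?_
        have hσ' := (hmem σ).1 hσ
        have hτ' := (hmem τ).1 hτ
        -- A kept local upper bound never equals a replaced one: only the latter contains the new
        -- position.
        have key : ∀ {σ τ : Fin p → Fin p → ℝ ×ₗ ℕ} {j : Fin p}, IsStored zr L τ →
            τ ≠ Function.update σ j (tag (L.length + 1) z) := by
          intro σ τ j hτ h
          have := hτ.snd_le j j
          rw [h] at this
          simp [tag] at this
        intro ρ h1 h2
        unfold updatedTagged at h1 h2
        split_ifs at h1 h2 with h h'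
        · obtain ⟨i, -, rfl⟩ := List.mem_map.1 h1
          obtain ⟨j, -, hij⟩ := List.mem_map.1 h2
          exact hne (hσ'.update_inj hN' hτ' h hij.symm).1
        · obtain ⟨i, -, rfl⟩ := List.mem_map.1 h1
          exact key hτ' (List.mem_singleton.1 h2).symm
        · obtain ⟨i, -, rfl⟩ := List.mem_map.1 h2
          exact key hσ' (List.mem_singleton.1 h1).symm
        · exact hne ((List.mem_singleton.1 h1).symm.trans (List.mem_singleton.1 h2))
    · rw [IsStored, setOf_mem_tagged_concat,
        isDefining_insert_iff (List.finite_toSet _) hz hN, List.mem_flatMap]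
      constructor
      · rintro ⟨σ, hσ, h⟩
        unfold updatedTagged at h
        split_ifs at h with h'
        · obtain ⟨j, hj, rfl⟩ := List.mem_map.1 h
          simp only [List.mem_filter, decide_eq_true_eq] at hj
          exact Or.inr ⟨σ, (hmem σ).1 hσ, h', j, hj.2, rfl⟩
        · rw [List.mem_singleton.1 h]
          exact Or.inl ⟨(hmem σ).1 hσ, h'⟩
      · rintro (⟨hτ, h⟩ | ⟨σ, hσ, h, j, hj, rfl⟩)
        · exact ⟨τ, (hmem τ).2 hτ, by simp [updatedTagged, h]⟩
        · refine ⟨σ, (hmem σ).2 hσ, ?_⟩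
          rw [updatedTagged, if_pos h]
          exact List.mem_map.2 ⟨j, by simpa using hj, rfl⟩
    · rw [ubsI_concat_val, insertI_val]
      refine (List.reverse_perm _).trans ((hperm.flatMap_right _).trans ?_)
      rw [List.flatMap_map, List.map_flatMap]
      refine List.Perm.of_eq (List.flatMap_congr fun σ hσ => ?_)
      exact (map_untag_updatedTagged ((hmem σ).1 hσ) z).symm

theorem card_tagged_le (L : List (Fin p → ℝ)) : (tagged L).toFinset.card ≤ L.length :=
  (List.toFinset_card_le _).trans_eq (length_tagged L)

/-- The count takes place among tagged vectors, which are determined by their diagonals. Real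
vectors that are stored several times because of ties are therefore counted with multiplicity. -/
theorem length_le_of_lubOn {zr : Fin p → ℝ} (hzr : ∀ j, 0 < zr j) {L : List (Fin p → ℝ)}
    (hL : ∀ z ∈ L, InBox zr z) {A : List (Fin p → Fin p → ℝ ×ₗ ℕ)} (hA : A.Nodup)
    (hAL : ∀ σ ∈ A, IsStored zr L σ) (J : Finset (Fin p))
    (hJ : ∀ σ ∈ A, LubOn J (tag 0 zr) {x | x ∈ tagged L} fun k => σ k k) :
    A.length ≤ lubConst J.card * (L.length + 1) ^ (J.card / 2) := by
  classical
  have hN := genPos_tagged hzr hL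
  have hinj : ∀ σ ∈ A, ∀ τ ∈ A, (fun k => σ k k) = (fun k => τ k k) → σ = τ :=
    fun σ hσ τ hτ h => (hAL σ hσ).ext_diag hN (hAL τ hτ) (congrFun h)
  have hcard := card_le_of_lubOn (top := tag 0 zr) J.card L.length J rfl (tagged L).toFinset
    (card_tagged_le L) (fun z hz => hN.lt_top z (by simpa using hz))
    (A.map fun σ k => σ k k).toFinset (fun u hu => by
      obtain ⟨σ, hσ, rfl⟩ := List.mem_map.1 (List.mem_toFinset.1 hu)
      simpa using hJ σ hσ)
  rwa [List.toFinset_card_of_nodup (hA.map_on hinj), List.length_map] at hcard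

/-- The number of local upper bounds that are stored by HBDA-I. -/
theorem length_ubsI_le (hp : 0 < p) {zr : Fin p → ℝ} (hzr : ∀ j, 0 < zr j)
    (L : List (Fin p → ℝ)) (hL : ∀ z ∈ L, InBox zr z) :
    (ubsI zr L).val.length ≤ lubConst p * (L.length + 1) ^ (p / 2) := by
  obtain ⟨A, hnodup, hmem, hperm⟩ := exists_stored_list hp hzr L hL
  rw [hperm.length_eq, List.length_map]
  simpa using length_le_of_lubOn hzr hL hnodup (fun σ => (hmem σ).1) Finset.univ
    fun σ hσ => ((hmem σ).1 hσ).lubOn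

/-- The number of local upper bounds with `u q = zr q` that are stored by HBDA-I. -/
theorem countP_ubsI_le (hp : 0 < p) {zr : Fin p → ℝ} (hzr : ∀ j, 0 < zr j)
    (L : List (Fin p → ℝ)) (hL : ∀ z ∈ L, InBox zr z) (q : Fin p) :
    (ubsI zr L).val.countP (fun e => e.u q = zr q) ≤
      lubConst (p - 1) * (L.length + 1) ^ ((p - 1) / 2) := by
  obtain ⟨A, hnodup, hmem, hperm⟩ := exists_stored_list hp hzr L hL
  rw [hperm.countP_eq, List.countP_map, List.countP_eq_length_filter]
  have h := length_le_of_lubOn hzr hL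
    (A := A.filter ((fun e : LUB p => decide (e.u q = zr q)) ∘ untag)) (hnodup.filter _)
    (fun σ hσ => (hmem σ).1 (List.mem_of_mem_filter hσ)) (Finset.univ.erase q) fun σ hσ => by
      obtain ⟨hσA, hq⟩ := List.mem_filter.1 hσ
      have hσ' := (hmem σ).1 hσA
      refine hσ'.lubOn_erase (genPos_tagged hzr hL) ?_
      -- Input points are strictly below `zr`, so equality with `zr q` in the real value forces the
      -- dummy point, hence equality of the tagged values.
      rcases hσ'.mem q with h | h
      · obtain ⟨i, hi, h⟩ := mem_tagged.1 h
        have h2 := (hL _ (L.getElem_mem hi) q).2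
        simp only [Function.comp, untag, ← h, tag, ofLex_toLex, decide_eq_true_eq] at hq
        exact absurd hq h2.ne
      · rw [h, dummy_self]
  simpa using h

end Tagged

/-! ## HBDA-I computes the hypervolume -/

section Volume

open MeasureTheory

variable {p : ℕ}

/-- The lower corner of the box of a stored local upper bound. -/
noncomputable def boxLower (e : LUB p) (j : Fin p) : ℝ :=
  if j.val = 0 then e.pts j j else (maxBefore e j).val

/-- The upper corner of the box of a stored local upper bound. -/
noncomputable def boxUpper (zr : Fin p → ℝ) (e : LUB p) (j : Fin p) : ℝ :=
  if j.val = 0 then zr j else e.u j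

/-- The box of a stored local upper bound, without its upper boundary. -/
def lubBox (zr : Fin p → ℝ) (e : LUB p) : Set (Fin p → ℝ) :=
  Set.univ.pi fun j => Set.Ico (boxLower e j) (boxUpper zr e j)

theorem boxVolume_val_eq_prod (zr : Fin p → ℝ) (e : LUB p) :
    (boxVolume zr e).val = ∏ j, (boxUpper zr e j - boxLower e j) := by
  rw [boxVolume_val]
  refine Finset.prod_congr rfl fun j _ => ?_
  rw [sideLength_val, boxUpper, boxLower]
  split_ifs <;> rfl

theorem IsStored.fst_le {zr : Fin p → ℝ} (hzr : ∀ j, 0 < zr j) {L : List (Fin p → ℝ)}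
    (hL : ∀ z ∈ L, InBox zr z) {σ : Fin p → Fin p → ℝ ×ₗ ℕ} (hσ : IsStored zr L σ)
    (k j : Fin p) : 0 ≤ (untag σ).pts k j ∧ (untag σ).pts k j ≤ zr j := by
  rcases hσ.mem k with h | h
  · obtain ⟨i, hi, h⟩ := mem_tagged.1 h
    have := hL _ (L.getElem_mem hi) j
    simp only [untag, ← h, tag, ofLex_toLex]
    exact ⟨this.1.le, this.2.le⟩
  · simp only [untag, h]
    by_cases hj : j = k
    · subst hj
      simp [tag, (hzr j).le]
    · simp [dummy_of_ne hj, lexBot, (hzr j).le]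

theorem IsStored.pts_le_u {zr : Fin p → ℝ} {L : List (Fin p → ℝ)}
    {σ : Fin p → Fin p → ℝ ×ₗ ℕ} (hσ : IsStored zr L σ) {k j : Fin p} (h : k ≠ j) :
    (untag σ).pts k j ≤ (untag σ).u j := by
  rcases Prod.Lex.lt_iff.1 (hσ.off k j h) with h | h
  · exact h.le
  · exact h.1.le

theorem IsStored.boxLower_le_boxUpper {zr : Fin p → ℝ} (hzr : ∀ j, 0 < zr j)
    {L : List (Fin p → ℝ)} (hL : ∀ z ∈ L, InBox zr z) {σ : Fin p → Fin p → ℝ ×ₗ ℕ}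
    (hσ : IsStored zr L σ) (j : Fin p) : boxLower (untag σ) j ≤ boxUpper zr (untag σ) j := by
  unfold boxLower boxUpper
  split_ifs
  · exact (hσ.fst_le hzr hL j j).2
  · rw [maxBefore_val_le_iff]
    exact ⟨(hσ.fst_le hzr hL j j).1, fun k hk => hσ.pts_le_u hk.ne⟩

/-- Tagging `y` with a position no smaller than any stored one turns the half-open real inequalities
into the tagged ones. The bounds `0 ≤ y` and `y < zr` are implicit in the real box but not in
`InLubBox`. -/
theorem IsStored.mem_lubBox_iff {zr : Fin p → ℝ} (hzr : ∀ j, 0 < zr j)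
    {L : List (Fin p → ℝ)} (hL : ∀ z ∈ L, InBox zr z) {σ : Fin p → Fin p → ℝ ×ₗ ℕ}
    (hσ : IsStored zr L σ) (y : Fin p → ℝ) :
    y ∈ lubBox zr (untag σ) ↔
      (∀ j, 0 ≤ y j ∧ y j < zr j) ∧ InLubBox σ (tag L.length y) := by
  simp only [lubBox, Set.mem_univ_pi, Set.mem_Ico, InLubBox, ← forall_and]
  refine forall_congr' fun j => ?_
  have h1 : ∀ k, σ k j ≤ tag L.length y j ↔ (untag σ).pts k j ≤ y j :=
    fun k => le_tag_iff (hσ.snd_le k j) y j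
  have h2 : tag L.length y j < σ j j ↔ y j < (untag σ).u j := tag_lt_iff (hσ.snd_le j j) y j
  have h3 := hσ.fst_le hzr hL j j
  simp only [h1, h2, boxLower, boxUpper]
  split_ifs
  · exact ⟨fun h => ⟨⟨h3.1.trans h.1, h.2⟩, h.1⟩, fun h => ⟨h.2, h.1.2⟩⟩
  · rw [maxBefore_val_le_iff]
    exact ⟨fun h => ⟨⟨h.1.1, h.2.trans_le h3.2⟩, h.1.2, h.2⟩,
      fun h => ⟨⟨h.1.1, h.2.1⟩, h.2.2⟩⟩

/-- Up to a null set, the dominated region is the disjoint union of the boxes. -/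
theorem iUnion_lubBox (hp : 0 < p) {zr : Fin p → ℝ} (hzr : ∀ j, 0 < zr j)
    {L : List (Fin p → ℝ)} (hL : ∀ z ∈ L, InBox zr z) :
    ⋃ σ ∈ {σ | IsStored zr L σ}, lubBox zr (untag σ) =
      {y | (∃ z ∈ L, z ≤ y) ∧ ∀ j, y j < zr j} := by
  have hN := genPos_tagged hzr hL
  have htop : ∀ {y : Fin p → ℝ}, (∀ j, y j < zr j) → ∀ j, tag L.length y j < tag 0 zr j :=
    fun h j => Prod.Lex.lt_iff.2 (Or.inl (h j))
  ext y
  simp only [Set.mem_iUnion, Set.mem_ofPred_eq, exists_prop]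
  constructor
  · rintro ⟨σ, hσ, hy⟩
    rw [hσ.mem_lubBox_iff hzr hL] at hy
    obtain ⟨x, hx, hle⟩ := hσ.exists_le hp hy.2 (htop fun j => (hy.1 j).2)
    obtain ⟨i, hi, rfl⟩ := mem_tagged.1 hx
    exact ⟨⟨L[i], L.getElem_mem hi, fun j => (le_tag_iff hi y j).1 (hle j)⟩,
      fun j => (hy.1 j).2⟩
  · rintro ⟨⟨z, hz, hle⟩, hy⟩
    obtain ⟨i, hi, rfl⟩ := List.mem_iff_getElem.1 hz
    obtain ⟨σ, hσ, hbox⟩ := exists_inLubBox hp hN (List.finite_toSet _)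
      ⟨_, mem_tagged.2 ⟨i, hi, rfl⟩, fun j => (le_tag_iff hi y j).2 (hle j)⟩ (htop hy)
    refine ⟨σ, hσ, (IsStored.mem_lubBox_iff hzr hL hσ y).2 ⟨fun j => ⟨?_, hy j⟩, hbox⟩⟩
    exact (hL _ hz j).1.le.trans (hle j)

/-- The two sets differ only on the hyperplanes `y j = zr j`, which are null sets. -/
theorem volume_dominatedRegion (zr : Fin p → ℝ) (L : List (Fin p → ℝ)) :
    volume (dominatedRegion zr {z | z ∈ L}) =
      volume {y | (∃ z ∈ L, z ≤ y) ∧ ∀ j, y j < zr j} := by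
  refine measure_congr ?_
  have h : ∀ᵐ y : Fin p → ℝ, ∀ j, y j ≠ zr j :=
    ae_all_iff.2 fun j => Measure.ae_eval_ne (μ := fun _ : Fin p => (volume : Measure ℝ)) j (zr j)
  filter_upwards [h] with y hy
  refine propext ⟨?_, ?_⟩
  · rintro ⟨z, hz, h1, h2⟩
    exact ⟨⟨z, hz, h1⟩, fun j => lt_of_le_of_ne (h2 j) (hy j)⟩
  · rintro ⟨⟨z, hz, h1⟩, h2⟩
    exact ⟨z, hz, h1, fun j => (h2 j).le⟩

theorem volume_lubBox {zr : Fin p → ℝ} (hzr : ∀ j, 0 < zr j)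
    {L : List (Fin p → ℝ)} (hL : ∀ z ∈ L, InBox zr z) {σ : Fin p → Fin p → ℝ ×ₗ ℕ}
    (hσ : IsStored zr L σ) :
    (volume (lubBox zr (untag σ))).toReal = (boxVolume zr (untag σ)).val := by
  rw [lubBox, Real.volume_pi_Ico_toReal (hσ.boxLower_le_boxUpper hzr hL), boxVolume_val_eq_prod]

/-- The boxes of the local upper bounds that HBDA-I stores have total volume `V(N)`. -/
theorem sum_boxVolume_ubsI (hp : 0 < p) {zr : Fin p → ℝ} (hzr : ∀ j, 0 < zr j)
    {L : List (Fin p → ℝ)} (hL : ∀ z ∈ L, InBox zr z) :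
    ((ubsI zr L).val.map fun e => (boxVolume zr e).val).sum = hypervolume zr {z | z ∈ L} := by
  classical
  obtain ⟨A, hnodup, hmem, hperm⟩ := exists_stored_list hp hzr L hL
  have hset : {σ | IsStored zr L σ} = (A.toFinset : Set _) := by
    ext σ
    simp [hmem]
  rw [(hperm.map _).sum_eq, List.map_map, hypervolume, volume_dominatedRegion,
    ← iUnion_lubBox hp hzr hL, hset]
  simp only [Finset.mem_coe]
  rw [measure_biUnion_finset, ENNReal.toReal_sum, List.sum_toFinset _ hnodup]
  · refine congrArg List.sum (List.map_congr_left fun σ hσ => ?_)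
    exact (volume_lubBox hzr hL ((hmem σ).1 hσ)).symm
  · intro σ _
    rw [lubBox, Real.volume_pi_Ico]
    exact ENNReal.prod_ne_top fun _ _ => ENNReal.ofReal_ne_top
  · intro σ hσ τ hτ hne
    have hσ' := (hmem σ).1 (by simpa using hσ)
    have hτ' := (hmem τ).1 (by simpa using hτ)
    refine Set.disjoint_left.2 fun y h1 h2 => hne ?_
    rw [hσ'.mem_lubBox_iff hzr hL] at h1
    rw [hτ'.mem_lubBox_iff hzr hL] at h2
    exact eq_of_inLubBox (genPos_tagged hzr hL) hσ' hτ' h1.2 h2.2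
  · exact fun σ _ => MeasurableSet.univ_pi fun j => measurableSet_Ico

theorem hbdaI_val (hp : 0 < p) {zr : Fin p → ℝ} (hzr : ∀ j, 0 < zr j)
    {L : List (Fin p → ℝ)} (hL : ∀ z ∈ L, InBox zr z) :
    (hbdaI zr L).val = hypervolume zr {z | z ∈ L} := by
  rw [← sum_boxVolume_ubsI hp hzr hL]
  simp [hbdaI, addBoxVolumes_val]

end Volume

/-! ## The nonincremental algorithm -/

section Nonincremental

variable {p : ℕ}

/-- The final state of HBDA-NI. -/
noncomputable def stateNI (q : Fin p) (zr : Fin p → ℝ) (L : List (Fin p → ℝ)) : StateNI p :=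
  L.foldl (fun s z => (insertNI q zr z s).val) ⟨[(topLUB zr).val], 0⟩

theorem stateNI_concat (q : Fin p) (zr : Fin p → ℝ) (L : List (Fin p → ℝ)) (z : Fin p → ℝ) :
    stateNI q zr (L ++ [z]) = (insertNI q zr z (stateNI q zr L)).val := by
  simp [stateNI]

open Classical in
-- With validity in component `q`, HBDA-I makes the replacements of HBDA-NI and, on a hit, exactly
-- one more: the final one in component `q`.
theorem updated_perm {q : Fin p} {z : Fin p → ℝ} {e : LUB p} (h : Valid z e q) :
    (updated (fun _ => True) z e).Perm (updated (fun j => j ≠ q) z e ++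
      if ∀ j, z j < e.u j then [replaced z e q] else []) := by
  unfold updated
  split_ifs
  · rw [← List.map_singleton, ← List.map_append]
    refine List.Perm.map _ ((List.perm_ext_iff_of_nodup ?_ ?_).2 fun j => ?_)
    · exact (List.nodup_finRange p).filter _
    · refine List.Nodup.append ((List.nodup_finRange p).filter _) (by simp) ?_
      simp
    · by_cases hj : j = q <;> simp [hj, h]
  · simp

theorem flatMap_ite_singleton {α β : Type*} (P : α → Prop) [DecidablePred P] (f : α → β) (l : List α) :
    (l.flatMap fun a => if P a then [f a] else []) = (l.filter P).map f := by
  induction l with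
  | nil => rfl
  | cons a l ih => by_cases h : P a <;> simp [ih, h]

/-- HBDA-I stores the local upper bounds that are stored by HBDA-NI, and those whose boxes HBDA-NI
has already accounted for. -/
theorem exists_final_list {q : Fin p} {zr : Fin p → ℝ} (L : List (Fin p → ℝ))
    (hL : ∀ z ∈ L, 0 < z q) (hsort : L.Pairwise fun y z => y q ≤ z q) :
    ∃ F : List (LUB p), (ubsI zr L).val.Perm ((stateNI q zr L).active ++ F) ∧
      (stateNI q zr L).vol = (F.map fun e => (boxVolume zr e).val).sum ∧
      (∀ e ∈ (stateNI q zr L).active, e.u q = zr q) ∧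
      ∀ x, 0 ≤ x → (∀ y ∈ L, y q ≤ x) →
        (∀ e ∈ (stateNI q zr L).active, ∀ k, k ≠ q → e.pts k q ≤ x) ∧ ∀ e ∈ F, e.u q ≤ x := by
  classical
  induction L using List.reverseRecOn with
  | nil =>
    refine ⟨[], by simp [ubsI_nil_val, stateNI], by simp [stateNI], by simp [stateNI, topLUB_val],
      fun x hx _ => ⟨?_, by simp⟩⟩
    simp only [stateNI, topLUB_val, List.foldl_nil, List.mem_singleton]
    rintro e rfl k hk
    simpa [Function.update_of_ne (Ne.symm hk)] using hx
  | append_singleton L z ih =>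
    rw [List.pairwise_append] at hsort
    obtain ⟨F, hperm, hvol, hu, hx⟩ := ih (fun y hy => hL y (by simp [hy])) hsort.1
    -- By sorting, `z q` bounds all earlier `q`-components. So every replacement in component `q` is
    -- valid, and no final vector can be hit; ties in component `q` do no harm. Positivity of `z q`
    -- takes care of the dummy points.
    obtain ⟨hpts, hF⟩ := hx (z q) (hL z (by simp)).le fun y hy => hsort.2.2 y hy z (by simp)
    rw [stateNI_concat, insertNI_val]
    set A := (stateNI q zr L).active
    refine ⟨(A.filter fun e => ∀ j, z j < e.u j).map (fun e => replaced z e q) ++ F,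
      ?_, ?_, ?_, fun x hx0 hxL => ⟨?_, ?_⟩⟩
    · rw [ubsI_concat_val, insertI_val]
      refine (List.reverse_perm _).trans ((hperm.flatMap_right _).trans ?_)
      rw [List.flatMap_append, ← List.append_assoc]
      refine List.Perm.append ?_ ?_
      · refine (List.Perm.flatMap_left _ fun e he => updated_perm (hpts e he)).trans ?_
        refine (List.flatMap_append_perm _ _ _).symm.trans ?_
        rw [flatMap_ite_singleton fun e : LUB p => ∀ j, z j < e.u j]
        exact (List.reverse_perm _).symm.append_right _
      · refine List.Perm.of_eq ((List.flatMap_congr fun e he => ?_).trans (List.flatMap_singleton' F))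
        -- Since `e.u q ≤ z q`, the strict hit test fails and HBDA-I leaves the final vectors
        -- unchanged.
        exact if_neg fun h => (h q).not_ge (hF e he)
    · simp only [List.map_append, List.sum_append, List.map_map, hvol, Function.comp_def]
      ring
    · simp only [List.mem_reverse, List.mem_flatMap]
      rintro e' ⟨e, he, h⟩
      unfold updated at h
      split_ifs at h
      · obtain ⟨j, hj, rfl⟩ := List.mem_map.1 h
        simp only [List.mem_filter, decide_eq_true_eq] at hj
        simp only [replaced, Function.update_of_ne (Ne.symm hj.2.1)]
        exact hu e he
      · rw [List.mem_singleton.1 h]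
        exact hu e he
    · have hold := (hx x hx0 fun y hy => hxL y (by simp [hy])).1
      simp only [List.mem_reverse, List.mem_flatMap]
      rintro e' ⟨e, he, h⟩ k hk
      unfold updated at h
      split_ifs at h
      · obtain ⟨j, hj, rfl⟩ := List.mem_map.1 h
        by_cases hkj : k = j
        · subst hkj
          simpa [replaced] using hxL z (by simp)
        · simpa [replaced, Function.update_of_ne hkj] using hold e he k hk
      · rw [List.mem_singleton.1 h]
        exact hold e he k hk
    · intro e he
      rcases List.mem_append.1 he with he | he
      · obtain ⟨e, -, rfl⟩ := List.mem_map.1 he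
        simpa [replaced] using hxL z (by simp)
      · exact (hx x hx0 fun y hy => hxL y (by simp [hy])).2 e he

theorem hbdaNI_val (hp : 0 < p) {q : Fin p} {zr : Fin p → ℝ} (hzr : ∀ j, 0 < zr j)
    {L : List (Fin p → ℝ)} (hL : ∀ z ∈ L, InBox zr z)
    (hsort : L.Pairwise fun y z => y q ≤ z q) :
    (hbdaNI q zr L).val = hypervolume zr {z | z ∈ L} := by
  obtain ⟨F, hperm, hvol, -⟩ := exists_final_list (zr := zr) L (fun z hz => (hL z hz q).1) hsort
  rw [← sum_boxVolume_ubsI hp hzr hL, (hperm.map _).sum_eq, List.map_append, List.sum_append,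
    ← hvol, add_comm]
  simp [hbdaNI, addBoxVolumes_val, loop_val, push, stateNI]

/-- The number of local upper bounds that are stored by HBDA-NI. -/
theorem length_active_le (hp : 0 < p) {q : Fin p} {zr : Fin p → ℝ} (hzr : ∀ j, 0 < zr j)
    {L : List (Fin p → ℝ)} (hL : ∀ z ∈ L, InBox zr z)
    (hsort : L.Pairwise fun y z => y q ≤ z q) :
    (stateNI q zr L).active.length ≤ lubConst (p - 1) * (L.length + 1) ^ ((p - 1) / 2) := by
  obtain ⟨F, hperm, -, hu, -⟩ := exists_final_list (zr := zr) L (fun z hz => (hL z hz q).1) hsort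
  refine le_trans ?_ (countP_ubsI_le hp hzr L hL q)
  rw [hperm.countP_eq, List.countP_append, List.countP_eq_length.2 (by simpa using hu)]
  exact Nat.le_add_right _ _

/-! ## Running times -/

/-- Here `a` is the initial cost, `c` the cost factor per point and `b` that of the final summation.
Since `n + 1 ≤ 2 * n`, each list size plus one is at most `(B * 2 ^ d + 1) * n ^ d`. -/
theorem steps_bound {a b c B n d s : ℕ} (hn : 1 ≤ n)
    (h : s ≤ a + n * (c * (B * (n + 1) ^ d + 1) + 1) + b * (B * (n + 1) ^ d + 1)) :
    s ≤ (a + (c + b) * (B * 2 ^ d + 1) + 1) * n ^ (d + 1) := by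
  have h1 : (n + 1) ^ d ≤ 2 ^ d * n ^ d := by
    rw [← mul_pow]
    exact Nat.pow_le_pow_left (by omega) d
  have h2 : 1 ≤ n ^ d := Nat.one_le_pow _ _ hn
  have h3 : B * (n + 1) ^ d + 1 ≤ (B * 2 ^ d + 1) * n ^ d := by nlinarith
  have h4 : 1 ≤ n ^ (d + 1) := Nat.one_le_pow _ _ hn
  have h5 : n ≤ n ^ (d + 1) := Nat.le_self_pow (by omega) n
  have h6 : n ^ d ≤ n ^ (d + 1) := Nat.pow_le_pow_right hn (by omega)
  have h7 : n * n ^ d = n ^ (d + 1) := by ring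
  set X := B * (n + 1) ^ d + 1
  set Y := B * 2 ^ d + 1
  calc s ≤ a + n * (c * X + 1) + b * X := h
    _ = a * 1 + c * (n * X) + n + b * X := by ring
    _ ≤ a * n ^ (d + 1) + c * (n * (Y * n ^ d)) + n ^ (d + 1) + b * (Y * n ^ (d + 1)) := by
        gcongr
        exact h3.trans (Nat.mul_le_mul_left _ h6)
    _ = (a + (c + b) * Y + 1) * n ^ (d + 1) := by
        rw [show n * (Y * n ^ d) = Y * n ^ (d + 1) by rw [← h7]; ring]
        ring

/-- The number of steps of a loop whose body takes time linear in a size that is bounded on all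
initial segments of the list. -/
theorem loop_steps_le_of_size {α β : Type} (f : β → α → TimeM β) (size : β → ℕ) (c D : ℕ)
    (hf : ∀ b a, (f b a).steps ≤ c * (size b + 1)) (b : β) (l : List α)
    (h : ∀ l', l' <+: l → size (loop f b l').val ≤ D) :
    (loop f b l).steps ≤ 1 + l.length * (c * (D + 1) + 1) := by
  induction l using List.reverseRecOn with
  | nil => simp [loop]
  | append_singleton l a ih =>
    have h1 := ih fun l' hl' => h l' (hl'.trans (List.prefix_append _ _))
    have h2 := hf (loop f b l).val a
    have h3 : c * (size (loop f b l).val + 1) ≤ c * (D + 1) :=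
      Nat.mul_le_mul_left _ (Nat.succ_le_succ (h l (List.prefix_append _ _)))
    rw [loop_concat_steps, List.length_append, List.length_singleton, add_mul, one_mul]
    omega

theorem bound_mono {B m n d : ℕ} (h : m ≤ n) : B * (m + 1) ^ d ≤ B * (n + 1) ^ d := by
  gcongr

/-- The constant in the bounds for the running times. -/
def timeConst (p B d : ℕ) : ℕ :=
  (p * (3 * p + 3) + 3) + ((stepBound p + 1) + ((5 * p + 7) * p + 3)) * (B * 2 ^ d + 1) + 1

theorem hbdaI_steps_le (hp : 0 < p) {zr : Fin p → ℝ} (hzr : ∀ j, 0 < zr j)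
    {L : List (Fin p → ℝ)} (hL : ∀ z ∈ L, InBox zr z) (hn : 1 ≤ L.length) :
    (hbdaI zr L).steps ≤ timeConst p (lubConst p) (p / 2) * L.length ^ (p / 2 + 1) := by
  have hval : ∀ l, (loop (fun U z => insertI z U) [(topLUB zr).val] l).val = (ubsI zr l).val := by
    intro l
    simp [ubsI, push]
  have h1 := loop_steps_le_of_size (fun U z => insertI z U) List.length (stepBound p + 1)
    (lubConst p * (L.length + 1) ^ (p / 2)) (fun U z => insertI_steps_le z U)
    [(topLUB zr).val] L fun l hl => by
      rw [hval]
      exact (length_ubsI_le hp hzr l fun z hz => hL z (hl.subset hz)).trans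
        (bound_mono hl.length_le)
  have h2 := addBoxVolumes_steps_le zr 0 (ubsI zr L).val
  have h3 := topLUB_steps_le zr
  have h4 : ((5 * p + 7) * p + 3) * ((ubsI zr L).val.length + 1) ≤ _ :=
    Nat.mul_le_mul_left _ (Nat.add_le_add_right (length_ubsI_le hp hzr L hL) 1)
  refine steps_bound hn ?_
  have h5 : (ubsI zr L).steps = (topLUB zr).steps + (1 +
      (loop (fun U z => insertI z U) [(topLUB zr).val] L).steps) := by
    simp [ubsI, push]
  rw [hbdaI, bind_steps, h5]
  omega

theorem hbdaNI_steps_le (hp : 0 < p) {q : Fin p} {zr : Fin p → ℝ} (hzr : ∀ j, 0 < zr j)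
    {L : List (Fin p → ℝ)} (hL : ∀ z ∈ L, InBox zr z)
    (hsort : L.Pairwise fun y z => y q ≤ z q) (hn : 1 ≤ L.length) :
    (hbdaNI q zr L).steps ≤
      timeConst p (lubConst (p - 1)) ((p - 1) / 2) * L.length ^ ((p - 1) / 2 + 1) := by
  have hval : ∀ l, (loop (fun s z => insertNI q zr z s) ⟨[(topLUB zr).val], 0⟩ l).val =
      stateNI q zr l := fun l => loop_val _ _ _
  have h1 := loop_steps_le_of_size (fun s z => insertNI q zr z s) (fun s => s.active.length)
    (stepBound p + 1) (lubConst (p - 1) * (L.length + 1) ^ ((p - 1) / 2))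
    (fun s z => insertNI_steps_le q zr z s) ⟨[(topLUB zr).val], 0⟩ L fun l hl => by
      rw [hval]
      exact (length_active_le hp hzr (fun z hz => hL z (hl.subset hz))
        (hsort.sublist hl.sublist)).trans (bound_mono hl.length_le)
  have h2 := addBoxVolumes_steps_le zr (stateNI q zr L).vol (stateNI q zr L).active
  have h3 := topLUB_steps_le zr
  have h4 : ((5 * p + 7) * p + 3) * ((stateNI q zr L).active.length + 1) ≤ _ :=
    Nat.mul_le_mul_left _ (Nat.add_le_add_right (length_active_le hp hzr hL hsort) 1)
  refine steps_bound hn ?_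
  have h5 : (hbdaNI q zr L).steps = (topLUB zr).steps + (1 +
      ((loop (fun s z => insertNI q zr z s) ⟨[(topLUB zr).val], 0⟩ L).steps +
        (addBoxVolumes zr (stateNI q zr L).vol (stateNI q zr L).active).steps)) := by
    simp [hbdaNI, push, ← hval]
  rw [h5]
  omega

end Nonincremental

/-! ## The size of the upper bound set -/

section UpperBoundSet

variable {p : ℕ}

/-- A component of a maximal `u` below `zr` cannot be raised, so some point blocks it, and this
point is its defining point. Conversely, each defining point would enter the box if its component
were raised. General position plays no role, so the counting bound applies to real vectors without
tags. -/
theorem mem_upperBoundSet_iff {zr : Fin p → ℝ} (hzr : ∀ j, 0 < zr j) {N : Finset (Fin p → ℝ)}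
    (hN : ∀ z ∈ N, InBox zr z) {u : Fin p → ℝ} :
    u ∈ upperBoundSet zr (N : Set (Fin p → ℝ)) ↔
      LubOn Finset.univ zr (N : Set (Fin p → ℝ)) u := by
  constructor
  · rintro ⟨⟨⟨hu0, hur⟩, hfree⟩, hmax⟩
    refine ⟨fun j hj => absurd (Finset.mem_univ j) hj, fun j _ => ?_, fun z hz => ?_⟩
    · by_contra! hcon
      obtain ⟨hne, hno⟩ := hcon
      have hlt : u j < zr j := lt_of_le_of_ne (hur j) hne
      -- The next critical value above `u j`: raising component `j` to `w` can let in only points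
      -- with `z j ≤ u j`, and freeness of `u` then leaves only `z j = u j`.
      obtain ⟨w, hw, hmin⟩ := Finset.exists_min_image
        (insert (zr j) ((N.image fun z => z j).filter fun a => u j < a)) id
        (Finset.insert_nonempty _ _)
      have huw : u j < w := by
        rcases Finset.mem_insert.1 hw with rfl | hw
        · exact hlt
        · exact (Finset.mem_filter.1 hw).2
      have huv : u ≤ Function.update u j w := le_update_self_iff.2 huw.le
      have hv : Function.update u j w ∈ Set.Icc 0 zr :=
        ⟨hu0.trans huv, update_le_iff.2 ⟨hmin _ (Finset.mem_insert_self _ _),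
          fun i _ => hur i⟩⟩
      have hnf : ¬ BoxFree (N : Set (Fin p → ℝ)) (Function.update u j w) := by
        intro hf
        have := hmax ⟨hv, hf⟩ huv j
        rw [Function.update_self] at this
        exact this.not_gt huw
      obtain ⟨z, hz, hzlt⟩ : ∃ z ∈ (N : Set (Fin p → ℝ)),
          ∀ i, 0 ≤ z i ∧ z i < Function.update u j w i := by
        by_contra h
        exact hnf fun z hz h' => h ⟨z, hz, h'⟩
      have hoff : ∀ i, i ≠ j → z i < u i := fun i hi => by
        have := (hzlt i).2
        rwa [Function.update_of_ne hi] at this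
      have hzw : z j < w := by
        have := (hzlt j).2
        rwa [Function.update_self] at this
      have hzj : z j = u j := by
        rcases lt_trichotomy (z j) (u j) with h | h | h
        · refine absurd (fun i => ⟨(hzlt i).1, ?_⟩) (hfree z hz)
          by_cases hi : i = j
          · exact hi ▸ h
          · exact hoff i hi
        · exact h
        · refine absurd (hmin (z j) (Finset.mem_insert_of_mem (Finset.mem_filter.2 ⟨?_, h⟩)))
            hzw.not_ge
          exact Finset.mem_image_of_mem (fun z : Fin p → ℝ => z j) hz
      obtain ⟨i, -, hi, hle⟩ := hno z hz hzj
      exact hle.not_gt (hoff i hi)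
    · by_contra! h
      exact hfree z hz fun j => ⟨(hN z hz j).1.le, h j (Finset.mem_univ j)⟩
  · intro hu
    have hbox : ∀ j, 0 < u j ∧ u j ≤ zr j := fun j => by
      rcases hu.defining j (Finset.mem_univ j) with h | ⟨z, hz, h, -⟩
      · rw [h]
        exact ⟨hzr j, le_rfl⟩
      · rw [← h]
        exact ⟨(hN z hz j).1, (hN z hz j).2.le⟩
    refine ⟨⟨⟨fun j => (hbox j).1.le, fun j => (hbox j).2⟩, fun z hz h => ?_⟩, ?_⟩
    · obtain ⟨j, -, hj⟩ := hu.free z hz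
      exact hj.not_gt (h j).2
    · rintro v ⟨⟨-, hvr⟩, hv⟩ huv j
      by_contra! hlt
      rcases hu.defining j (Finset.mem_univ j) with h | ⟨z, hz, h, hz'⟩
      · rw [h] at hlt
        exact (hvr j).not_gt hlt
      · refine hv z hz fun i => ⟨(hN z hz i).1.le, ?_⟩
        by_cases hi : i = j
        · subst hi
          rw [h]
          exact hlt
        · exact (hz' i (Finset.mem_univ i) hi).trans_le (huv i)

/-- The counting bound holds for every finite subset, and this uniformity also gives finiteness. -/
theorem upperBoundSet_finite_and_ncard_le {zr : Fin p → ℝ} (hzr : ∀ j, 0 < zr j)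
    {N : Finset (Fin p → ℝ)} (hN : ∀ z ∈ N, InBox zr z) :
    (upperBoundSet zr (N : Set (Fin p → ℝ))).Finite ∧
      (upperBoundSet zr (N : Set (Fin p → ℝ))).ncard ≤ lubConst p * (N.card + 1) ^ (p / 2) := by
  have key : ∀ T : Finset (Fin p → ℝ), (T : Set _) ⊆ upperBoundSet zr (N : Set (Fin p → ℝ)) →
      T.card ≤ lubConst p * (N.card + 1) ^ (p / 2) := fun T hT =>
    card_le_of_lubOn p N.card Finset.univ (by simp) N le_rfl (fun z hz j => (hN z hz j).2) T
      fun u hu => (mem_upperBoundSet_iff hzr hN).1 (hT hu)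
  have hfin : (upperBoundSet zr (N : Set (Fin p → ℝ))).Finite := by
    by_contra hinf
    obtain ⟨T, hT, hcard⟩ := Set.Infinite.exists_subset_card_eq hinf
      (lubConst p * (N.card + 1) ^ (p / 2) + 1)
    have := key T hT
    omega
  refine ⟨hfin, ?_⟩
  rw [Set.ncard_eq_toFinset_card _ hfin]
  exact key _ (by simp)

/-! ### Many local upper bounds

The `n` points are divided into `p / 2` groups. The points of group `i` form a staircase in the
components `2 * i` and `2 * i + 1`, and they are small in the other components. -/

/-- A small strictly increasing sequence. -/
noncomputable def smallSeq (n s : ℕ) : ℝ := (s + 1) / (4 * (n + 1))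

theorem smallSeq_pos (n s : ℕ) : 0 < smallSeq n s := by
  unfold smallSeq
  positivity

theorem smallSeq_lt {n s : ℕ} (h : s < n) : smallSeq n s < 1 / 4 := by
  have : (s : ℝ) < n := by exact_mod_cast h
  unfold smallSeq
  rw [div_lt_div_iff₀ (by positivity) (by norm_num)]
  linarith

theorem smallSeq_strictMono (n : ℕ) : StrictMono (smallSeq n) := by
  intro s t h
  have : (s : ℝ) < t := by exact_mod_cast h
  unfold smallSeq
  gcongr

/-- The relative position of the `s`-th point in component `j`. -/
noncomputable def stairPos (m n s j : ℕ) : ℝ :=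
  if j / 2 = s % m then
    if j % 2 = 0 then 1 / 2 + smallSeq n s else 3 / 4 - smallSeq n s
  else smallSeq n s

/-- The relative position in component `j` of the local upper bound that is given by a position
`t i` on the staircase of each group `i`. -/
noncomputable def cornerPos (m n : ℕ) (t : ℕ → ℕ) (j : ℕ) : ℝ :=
  if j % 2 = 0 then
    if j / 2 < m ∧ t (j / 2) * m + j / 2 < n then
      1 / 2 + smallSeq n (t (j / 2) * m + j / 2) else 1
  else if t (j / 2) = 0 then 1 else 3 / 4 - smallSeq n ((t (j / 2) - 1) * m + j / 2)

theorem stairPos_mem {m n s : ℕ} (h : s < n) (j : ℕ) :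
    0 < stairPos m n s j ∧ stairPos m n s j < 1 := by
  have h1 := smallSeq_pos n s
  have h2 := smallSeq_lt h
  unfold stairPos
  split_ifs <;> constructor <;> linarith

/-- All values of `smallSeq` are below `1 / 4`, so staircase components lie between `1 / 2` and `3 /
4`, and the others below `1 / 4`. Hence the two kinds never collide, and within each kind `smallSeq`
is injective. -/
theorem stairPos_inj {m n s t : ℕ} (hs : s < n) (ht : t < n) {j : ℕ}
    (h : stairPos m n s j = stairPos m n t j) : s = t := by
  have h1 := smallSeq_pos n s
  have h2 := smallSeq_lt hs
  have h3 := smallSeq_pos n t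
  have h4 := smallSeq_lt ht
  refine (smallSeq_strictMono n).injective ?_
  unfold stairPos at h
  split_ifs at h <;> linarith

/-- Points of one group rise in the even and fall in the odd component of their pair; a point of
another group is small in both. -/
theorem exists_stairPos_lt {m n s t : ℕ} (hm : 0 < m) (ht : t < n) (hne : s ≠ t) :
    ∃ j < 2 * m, stairPos m n t j < stairPos m n s j := by
  have h1 := smallSeq_pos n s
  have h4 := smallSeq_lt ht
  have hmod := Nat.mod_lt s hm
  have e1 : 2 * (s % m) / 2 = s % m := by omega
  have e2 : (2 * (s % m) + 1) / 2 = s % m := by omega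
  by_cases h : s % m = t % m
  · rcases lt_or_gt_of_ne hne with hlt | hlt
    · refine ⟨2 * (s % m) + 1, by omega, ?_⟩
      have := smallSeq_strictMono n hlt
      simp only [stairPos, e2, ← h, if_true]
      rw [if_neg (by omega), if_neg (by omega)]
      linarith
    · refine ⟨2 * (s % m), by omega, ?_⟩
      have := smallSeq_strictMono n hlt
      simp only [stairPos, e1, ← h, if_true]
      rw [if_pos (by omega), if_pos (by omega)]
      linarith
  · refine ⟨2 * (s % m), by omega, ?_⟩
    simp only [stairPos, e1, h, if_true, if_false]
    rw [if_pos (by omega)]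
    linarith

/-- A point `s` is number `s / m` of group `s % m`. From number `t i` on it reaches the corner in
the even component of its pair, before that in the odd one. -/
theorem exists_cornerPos_le {m n s : ℕ} (hm : 0 < m) (hs : s < n) (t : ℕ → ℕ) :
    ∃ j < 2 * m, cornerPos m n t j ≤ stairPos m n s j := by
  have hmod := Nat.mod_lt s hm
  have e1 : 2 * (s % m) / 2 = s % m := by omega
  have e2 : (2 * (s % m) + 1) / 2 = s % m := by omega
  have hdiv : s / m * m + s % m = s := Nat.div_add_mod' s m
  rcases le_or_gt (t (s % m)) (s / m) with h | h
  · have hle : t (s % m) * m + s % m ≤ s :=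
      (Nat.add_le_add_right (Nat.mul_le_mul_right m h) _).trans_eq hdiv
    refine ⟨2 * (s % m), by omega, ?_⟩
    have := (smallSeq_strictMono n).monotone hle
    simp only [stairPos, cornerPos, e1, if_true]
    rw [if_pos (by omega), if_pos ⟨hmod, hle.trans_lt hs⟩, if_pos (by omega)]
    linarith
  · have hle : s ≤ (t (s % m) - 1) * m + s % m :=
      hdiv.symm.trans_le (Nat.add_le_add_right (Nat.mul_le_mul_right m (by omega)) _)
    refine ⟨2 * (s % m) + 1, by omega, ?_⟩
    have := (smallSeq_strictMono n).monotone hle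
    simp only [stairPos, cornerPos, e2, if_true]
    rw [if_neg (by omega), if_neg (Nat.ne_zero_of_lt h), if_neg (by omega)]
    linarith

theorem half_lt_cornerPos {m n : ℕ} {t : ℕ → ℕ}
    (ht : ∀ i < m, t i ≠ 0 → (t i - 1) * m + i < n) {j : ℕ} (hj : j % 2 = 1 → j / 2 < m) :
    1 / 2 < cornerPos m n t j := by
  unfold cornerPos
  split_ifs with h1 h2 h3
  · have := smallSeq_pos n (t (j / 2) * m + j / 2)
    linarith
  · norm_num
  · norm_num
  · have := smallSeq_lt (ht _ (hj (by omega)) h3)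
    linarith

/-- In pair `i` the corner lies between consecutive stair points: number `t i` defines the even
component and number `t i - 1` the odd one; where such a point is missing, the value is `1`. All
corner components exceed `1 / 2`, so points of other groups are below. For odd `p` the last,
unpaired component has an even index and the value `1`. -/
theorem cornerPos_eq_one_or {m n : ℕ} {t : ℕ → ℕ}
    (ht : ∀ i < m, t i ≠ 0 → (t i - 1) * m + i < n) {j : ℕ} (hj : j % 2 = 1 → j / 2 < m) :
    cornerPos m n t j = 1 ∨ ∃ s < n, stairPos m n s j = cornerPos m n t j ∧
      ∀ k, k ≠ j → (k % 2 = 1 → k / 2 < m) → stairPos m n s k < cornerPos m n t k := by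
  have hsmall : ∀ s < n, s % m = j / 2 → ∀ k, k / 2 ≠ j / 2 → (k % 2 = 1 → k / 2 < m) →
      stairPos m n s k < cornerPos m n t k := by
    intro s hs hsj k hk hkm
    have h1 := half_lt_cornerPos ht hkm
    have h2 := smallSeq_lt hs
    rw [stairPos, if_neg (by rwa [hsj])]
    linarith
  by_cases hpar : j % 2 = 0
  · by_cases h : j / 2 < m ∧ t (j / 2) * m + j / 2 < n
    · right
      set s := t (j / 2) * m + j / 2 with hs
      have hsj : s % m = j / 2 := by rw [hs, Nat.mul_add_mod_self_right, Nat.mod_eq_of_lt h.1]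
      have h0 := smallSeq_pos n s
      refine ⟨s, h.2, ?_, fun k hk hkm => ?_⟩
      · rw [stairPos, if_pos hsj.symm, if_pos hpar, cornerPos, if_pos hpar, if_pos h]
      · by_cases hkj : k / 2 = j / 2
        · rw [stairPos, if_pos (hkj.trans hsj.symm), if_neg (by omega), cornerPos,
            if_neg (by omega), hkj]
          split_ifs with ht0
          · linarith
          · have : (t (j / 2) - 1) * m + j / 2 < s := by
              rw [hs]
              exact Nat.add_lt_add_right (Nat.mul_lt_mul_of_pos_right (by omega) (by omega)) _
            have := smallSeq_strictMono n this
            linarith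
        · exact hsmall s h.2 hsj k hkj hkm
    · left
      rw [cornerPos, if_pos hpar, if_neg h]
  · by_cases h : t (j / 2) = 0
    · left
      rw [cornerPos, if_neg hpar, if_pos h]
    · right
      have hjm := hj (by omega)
      set s := (t (j / 2) - 1) * m + j / 2 with hs
      have hsn : s < n := ht _ hjm h
      have hsj : s % m = j / 2 := by rw [hs, Nat.mul_add_mod_self_right, Nat.mod_eq_of_lt hjm]
      have h0 := smallSeq_lt hsn
      refine ⟨s, hsn, ?_, fun k hk hkm => ?_⟩
      · rw [stairPos, if_pos hsj.symm, if_neg hpar, cornerPos, if_neg hpar, if_neg h]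
      · by_cases hkj : k / 2 = j / 2
        · rw [stairPos, if_pos (hkj.trans hsj.symm), if_pos (by omega), cornerPos,
            if_pos (by omega), hkj]
          split_ifs
          · have : s < t (j / 2) * m + j / 2 := by
              rw [hs]
              exact Nat.add_lt_add_right (Nat.mul_lt_mul_of_pos_right (by omega) (by omega)) _
            have := smallSeq_strictMono n this
            linarith
          · linarith
        · exact hsmall s hsn hsj k hkj hkm

/-- The odd component alone encodes `t i`: the value `1` means `0`, and otherwise it is below `3 /
4` and injective in `t i`. -/
theorem cornerPos_odd_inj {m n : ℕ} {t t' : ℕ → ℕ} {i : ℕ} (hm : 0 < m)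
    (h : cornerPos m n t (2 * i + 1) = cornerPos m n t' (2 * i + 1)) : t i = t' i := by
  have e : (2 * i + 1) / 2 = i := by omega
  have e' : (2 * i + 1) % 2 ≠ 0 := by omega
  simp only [cornerPos, e, if_neg e'] at h
  split_ifs at h with h1 h2 h2
  · omega
  · have := smallSeq_pos n ((t' i - 1) * m + i)
    linarith
  · have := smallSeq_pos n ((t i - 1) * m + i)
    linarith
  · have h3 := (smallSeq_strictMono n).injective (sub_right_injective h)
    have h4 := Nat.eq_of_mul_eq_mul_right hm (Nat.add_right_cancel h3)
    omega

/-- The `s`-th point of the construction. -/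
noncomputable def stairPoint (zr : Fin p → ℝ) (n s : ℕ) : Fin p → ℝ :=
  fun j => zr j * stairPos (p / 2) n s j

/-- The local upper bound that is given by the positions `t`. -/
noncomputable def cornerPoint (zr : Fin p → ℝ) (n : ℕ) (t : ℕ → ℕ) : Fin p → ℝ :=
  fun j => zr j * cornerPos (p / 2) n t j

theorem exists_large_upperBoundSet (hp : 2 ≤ p) {zr : Fin p → ℝ} (hzr : ∀ j, 0 < zr j) (n : ℕ) :
    ∃ N : Finset (Fin p → ℝ), N.card = n ∧ (∀ z ∈ N, InBox zr z) ∧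
      Stable (N : Set (Fin p → ℝ)) ∧ GeneralPosition (N : Set (Fin p → ℝ)) ∧
      (n / (p / 2) + 1) ^ (p / 2) ≤ (upperBoundSet zr (N : Set (Fin p → ℝ))).ncard := by
  classical
  set m := p / 2 with hm
  have hm0 : 0 < m := by omega
  have hodd : ∀ j : Fin p, j.val % 2 = 1 → j.val / 2 < m := fun j hj => by
    have := j.isLt
    omega
  set N := (Finset.range n).image (stairPoint zr n) with hNdef
  have hmemN : ∀ z ∈ N, ∃ s < n, stairPoint zr n s = z := fun z hz => by
    simpa [hNdef] using hz
  have hinj : ∀ s < n, ∀ t < n, ∀ j : Fin p, stairPoint zr n s j = stairPoint zr n t j → s = t :=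
    fun s hs t ht j h => stairPos_inj hs ht (mul_left_cancel₀ (hzr j).ne' h)
  have hbox : ∀ z ∈ N, InBox zr z := by
    intro z hz j
    obtain ⟨s, hs, rfl⟩ := hmemN z hz
    obtain ⟨h1, h2⟩ := stairPos_mem (m := m) hs j
    exact ⟨mul_pos (hzr j) h1, mul_lt_of_lt_one_right (hzr j) h2⟩
  refine ⟨N, ?_, hbox, ?_, ?_, ?_⟩
  · rw [hNdef, Finset.card_image_of_injOn, Finset.card_range]
    intro s hs t ht h
    exact hinj s (by simpa using hs) t (by simpa using ht) ⟨0, by omega⟩ (congrFun h _)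
  · rintro y hy z hz ⟨hle, hne⟩
    obtain ⟨s, hs, rfl⟩ := hmemN y hy
    obtain ⟨t, ht, rfl⟩ := hmemN z hz
    obtain ⟨j, hj, hlt⟩ := exists_stairPos_lt hm0 ht fun h => hne (h ▸ rfl)
    have hjp : j < p := by omega
    exact (mul_lt_mul_of_pos_left hlt (hzr ⟨j, hjp⟩)).not_ge (hle ⟨j, hjp⟩)
  · intro j y hy z hz h
    obtain ⟨s, hs, rfl⟩ := hmemN y hy
    obtain ⟨t, ht, rfl⟩ := hmemN z hz
    rw [hinj s hs t ht j h]
  -- Each group contains at least `n / m` points and so offers `n / m + 1` corners; the choices in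
  -- the `m` groups are independent.
  · set ext : (Fin m → Fin (n / m + 1)) → ℕ → ℕ :=
      fun t i => if h : i < m then (t ⟨i, h⟩).val else 0 with hext
    have hextlt : ∀ t, ∀ i < m, ext t i ≠ 0 → (ext t i - 1) * m + i < n := by
      intro t i hi h0
      have h1 : ext t i ≤ n / m := by
        simp only [hext, dif_pos hi]
        exact Nat.lt_succ_iff.1 (t ⟨i, hi⟩).isLt
      have h2 : (ext t i - 1) * m + m ≤ n := by
        rw [← Nat.succ_mul, Nat.succ_eq_add_one, Nat.sub_add_cancel (Nat.pos_of_ne_zero h0)]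
        exact (Nat.mul_le_mul_right m h1).trans (Nat.div_mul_le_self n m)
      omega
    have hfin := (upperBoundSet_finite_and_ncard_le hzr hbox).1
    have hinjc : Function.Injective fun t => cornerPoint zr n (ext t) := by
      intro t t' h
      funext i
      have hi : 2 * i.val + 1 < p := by
        have := i.isLt
        omega
      have h1 := cornerPos_odd_inj hm0
        (mul_left_cancel₀ (hzr ⟨2 * i.val + 1, hi⟩).ne' (congrFun h ⟨2 * i.val + 1, hi⟩))
      simp only [hext, i.isLt, dif_pos] at h1
      exact Fin.ext h1
    have hcard : (Finset.univ.image fun t => cornerPoint zr n (ext t)).card =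
        (n / m + 1) ^ m := by
      rw [Finset.card_image_of_injective _ hinjc]
      simp
    rw [← hcard, ← Set.ncard_coe_finset]
    refine Set.ncard_le_ncard ?_ hfin
    intro u hu
    obtain ⟨t, -, rfl⟩ := Finset.mem_image.1 (Finset.mem_coe.1 hu)
    refine (mem_upperBoundSet_iff hzr hbox).2
      ⟨fun j hj => absurd (Finset.mem_univ j) hj, fun j _ => ?_, fun z hz => ?_⟩
    · rcases cornerPos_eq_one_or (hextlt t) (hodd j) with h | ⟨s, hs, h1, h2⟩
      · left
        rw [cornerPoint, ← hm, h, mul_one]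
      · refine Or.inr ⟨stairPoint zr n s, ?_, ?_, fun i _ hij => ?_⟩
        · exact Finset.mem_coe.2 (Finset.mem_image_of_mem _ (Finset.mem_range.2 hs))
        · rw [stairPoint, cornerPoint, ← hm, h1]
        · exact mul_lt_mul_of_pos_left (h2 i (fun h => hij (Fin.ext h)) (hodd i)) (hzr i)
    · obtain ⟨s, hs, rfl⟩ := hmemN z hz
      obtain ⟨j, hj, hle⟩ := exists_cornerPos_le hm0 hs (ext t)
      have hjp : j < p := by omega
      exact ⟨⟨j, hjp⟩, Finset.mem_univ _, mul_le_mul_of_nonneg_left hle (hzr _).le⟩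

end UpperBoundSet

end HBDA

/-! ### Assembly of the claims and the constants of the `Θ` bound. -/

theorem mainTheorem4 (p : ℕ) (hp : 2 ≤ p) :
    -- HBDA-I computes the hypervolume of `n` points in time `O(n ^ (⌊p / 2⌋ + 1))`
    (∃ C : ℕ, ∀ (zr : Fin p → ℝ) (L : List (Fin p → ℝ)), HBDA.IsInput zr L →
      (HBDA.hbdaI zr L).val = HBDA.hypervolume zr {z | z ∈ L} ∧
      (1 ≤ L.length → (HBDA.hbdaI zr L).steps ≤ C * L.length ^ (p / 2 + 1))) ∧
    -- HBDA-NI, on points sorted by a component `q`: time `O(n ^ (⌊(p - 1) / 2⌋ + 1))`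
    (∃ C : ℕ, ∀ (q : Fin p) (zr : Fin p → ℝ) (L : List (Fin p → ℝ)), HBDA.IsInput zr L →
      L.Pairwise (fun y z => y q ≤ z q) →
      (HBDA.hbdaNI q zr L).val = HBDA.hypervolume zr {z | z ∈ L} ∧
      (1 ≤ L.length → (HBDA.hbdaNI q zr L).steps ≤ C * L.length ^ ((p - 1) / 2 + 1))) ∧
    -- constant work per stored local upper bound when a point is processed
    (∃ K : ℕ,
      (∀ (z : Fin p → ℝ) (acc : List (HBDA.LUB p)) (e : HBDA.LUB p),
        (HBDA.updateI z acc e).steps ≤ K) ∧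
      (∀ (z : Fin p → ℝ) (U : List (HBDA.LUB p)),
        (HBDA.insertI z U).steps ≤ K * (U.length + 1)) ∧
      (∀ (q : Fin p) (zr z : Fin p → ℝ) (s : HBDA.StateNI p) (e : HBDA.LUB p),
        (HBDA.updateNI q zr z s e).steps ≤ K) ∧
      (∀ (q : Fin p) (zr z : Fin p → ℝ) (s : HBDA.StateNI p),
        (HBDA.insertNI q zr z s).steps ≤ K * (s.active.length + 1))) ∧
    -- the worst-case size of the upper bound set of `n` points is `Θ(n ^ ⌊p / 2⌋)`
    (∃ c C : ℝ, 0 < c ∧ 0 < C ∧ ∀ zr : Fin p → ℝ, (∀ j, 0 < zr j) → ∀ n : ℕ, 1 ≤ n →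
      (∀ N : Finset (Fin p → ℝ), N.card = n → (∀ z ∈ N, HBDA.InBox zr z) →
        HBDA.Stable (N : Set (Fin p → ℝ)) →
        (HBDA.upperBoundSet zr (N : Set (Fin p → ℝ))).Finite ∧
        ((HBDA.upperBoundSet zr (N : Set (Fin p → ℝ))).ncard : ℝ) ≤ C * (n : ℝ) ^ (p / 2)) ∧
      (∃ N : Finset (Fin p → ℝ), N.card = n ∧ (∀ z ∈ N, HBDA.InBox zr z) ∧
        HBDA.Stable (N : Set (Fin p → ℝ)) ∧ HBDA.GeneralPosition (N : Set (Fin p → ℝ)) ∧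
        c * (n : ℝ) ^ (p / 2) ≤
          ((HBDA.upperBoundSet zr (N : Set (Fin p → ℝ))).ncard : ℝ))) := by
  have hp0 : 0 < p := by omega
  refine ⟨⟨_, fun zr L h => ⟨HBDA.hbdaI_val hp0 h.zr_pos h.inBox,
      HBDA.hbdaI_steps_le hp0 h.zr_pos h.inBox⟩⟩,
    ⟨_, fun q zr L h hsort => ⟨HBDA.hbdaNI_val hp0 h.zr_pos h.inBox hsort,
      HBDA.hbdaNI_steps_le hp0 h.zr_pos h.inBox hsort⟩⟩,
    ⟨HBDA.stepBound p + 1, fun z acc e => (HBDA.updateI_steps_le z acc e).trans (Nat.le_succ _),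
      HBDA.insertI_steps_le,
      fun q zr z s e => (HBDA.updateNI_steps_le q zr z s e).trans (Nat.le_succ _),
      HBDA.insertNI_steps_le⟩,
    -- With `m = p / 2`, the lower constant comes from `n ≤ m * (n / m + 1)`. In the upper one, `2 ^
    -- m` absorbs `n + 1 ≤ 2 * n`, and the summand `1` only makes positivity evident.
    1 / ((p / 2 : ℕ) : ℝ) ^ (p / 2), HBDA.lubConst p * 2 ^ (p / 2) + 1, ?_, by positivity,
    fun zr hzr n hn => ⟨fun N hcard hN _ => ?_, ?_⟩⟩
  · have : 0 < p / 2 := by omega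
    positivity
  · obtain ⟨hfin, hle⟩ := HBDA.upperBoundSet_finite_and_ncard_le hzr hN
    refine ⟨hfin, ?_⟩
    have hn' : (1 : ℝ) ≤ n := by exact_mod_cast hn
    have h1 : ((n : ℝ) + 1) ^ (p / 2) ≤ 2 ^ (p / 2) * (n : ℝ) ^ (p / 2) := by
      rw [← mul_pow]
      exact pow_le_pow_left₀ (by positivity) (by linarith) _
    calc ((HBDA.upperBoundSet zr (N : Set (Fin p → ℝ))).ncard : ℝ)
        ≤ HBDA.lubConst p * ((n : ℝ) + 1) ^ (p / 2) := by
          rw [hcard] at hle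
          exact_mod_cast hle
      _ ≤ HBDA.lubConst p * (2 ^ (p / 2) * (n : ℝ) ^ (p / 2)) + (n : ℝ) ^ (p / 2) :=
          (mul_le_mul_of_nonneg_left h1 (Nat.cast_nonneg _)).trans
            (le_add_of_nonneg_right (by positivity))
      _ = (HBDA.lubConst p * 2 ^ (p / 2) + 1) * (n : ℝ) ^ (p / 2) := by ring
  · obtain ⟨N, hcard, hN, hstable, hgen, hle⟩ := HBDA.exists_large_upperBoundSet hp hzr n
    refine ⟨N, hcard, hN, hstable, hgen, ?_⟩
    have hm : 0 < p / 2 := by omega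
    have h1 : n ≤ (p / 2) * (n / (p / 2) + 1) := (Nat.lt_mul_div_succ n hm).le
    have h2 : n ^ (p / 2) ≤ (p / 2) ^ (p / 2) *
        (HBDA.upperBoundSet zr (N : Set (Fin p → ℝ))).ncard :=
      (Nat.pow_le_pow_left h1 _).trans (by rw [mul_pow]; exact Nat.mul_le_mul_left _ hle)
    have hm' : (0 : ℝ) < ((p / 2 : ℕ) : ℝ) ^ (p / 2) := by positivity
    rw [div_mul_eq_mul_div, one_mul, div_le_iff₀' hm']
    exact_mod_cast h2
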